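/- Let $m \ge 2$, let $D \subset \mathbb{R}^m$ be a bounded domain (a non-empty bounded connected open set), let $\lambda \in \mathbb{C}$, and let $u \in C^1(D) \cap C^0(\overline D)$ be real-valued. Write $B_r(x)$ for the open ball of radius $r > 0$ centred at $x$, and call it admissible if $\overline{B_r(x)} \subset D$. For admissible balls put $$M^\circ(u,x,r) = \frac{1}{|\partial B_r|}\int_{\partial B_r(x)} u \, dS, \qquad M^\bullet(u,x,r) = \frac{1}{|B_r|}\int_{B_r(x)} u \, dy, \qquad F(u,x,r) = \frac{1}{|\partial B_r|}\int_{\partial B_r(x)} \frac{\partial u}{\partial n} \, dS,$$ where $n$ is the exterior unit normal to $\partial B_r(x)$. Suppose that for all sufficiently small $r > 0$ the functions $F(u,\cdot,r)$ and $M^\circ(u,\cdot,r)$ are of class $C^2$ on the set $\{x : \overline{B_r(x)} \subset D\}$. Suppose further that for every $x \in D$ there is given a number $r(x) > 0$ such that $B_{r(x)}(x)$ is admissible, and that $$m \, F(u,x,r) = -\lambda^2 \, r \, M^\bullet(u,x,r) \qquad \text{for all } x \in D \text{ and all } r \in (0, r(x)].$$ Then $u$ is metaharmonic in $D$, that is,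 $u \in C^2(D)$ and $\nabla^2 u + \lambda^2 u = 0$ in $D$. -/

import Mathlib

open MeasureTheory Metric Set

noncomputable section

/-- The surface integral of `f` over the sphere `∂B_r(x)` in `ℝᵐ`, computed with the surface
measure of the unit sphere: `∫_{∂B_r(x)} f dS = r^{m-1} ∫_{|θ|=1} f (x + r θ) dS_θ`. -/
def sphereIntegral {m : ℕ} (f : EuclideanSpace ℝ (Fin m) → ℝ)
    (x : EuclideanSpace ℝ (Fin m)) (r : ℝ) : ℝ :=
  r ^ (m - 1) * ∫ θ : sphere (0 : EuclideanSpace ℝ (Fin m)) 1,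
      f (x + r • (θ : EuclideanSpace ℝ (Fin m)))
    ∂(volume : Measure (EuclideanSpace ℝ (Fin m))).toSphere

/-- The area `|∂B_r| = 2 π^{m/2} r^{m-1} / Γ(m/2)` of a sphere of radius `r` in `ℝᵐ`. -/
def sphereArea (m : ℕ) (r : ℝ) : ℝ :=
  2 * Real.pi ^ ((m : ℝ) / 2) * r ^ (m - 1) / Real.Gamma ((m : ℝ) / 2)

/-- The mean value `M°(u, x, r)` of `u` over the sphere `∂B_r(x)`. -/
def sphereMean {m : ℕ} (u : EuclideanSpace ℝ (Fin m) → ℝ)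
    (x : EuclideanSpace ℝ (Fin m)) (r : ℝ) : ℝ :=
  (sphereArea m r)⁻¹ * sphereIntegral u x r

/-- The mean value `M•(u, x, r)` of `u` over the ball `B_r(x)`. -/
def ballMean {m : ℕ} (u : EuclideanSpace ℝ (Fin m) → ℝ)
    (x : EuclideanSpace ℝ (Fin m)) (r : ℝ) : ℝ :=
  (volume.real (ball x r))⁻¹ * ∫ y in ball x r, u y

/-- The derivative of `u` at a point `y` of `∂B_r(x)` in the direction of the exterior unit
normal `(y - x) / r`. -/
def normalDeriv {m : ℕ} (u : EuclideanSpace ℝ (Fin m) → ℝ)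
    (x : EuclideanSpace ℝ (Fin m)) (r : ℝ) (y : EuclideanSpace ℝ (Fin m)) : ℝ :=
  fderiv ℝ u y (r⁻¹ • (y - x))

/-- The mean flux `F(u, x, r)` of `u` through the sphere `∂B_r(x)`. -/
def meanFlux {m : ℕ} (u : EuclideanSpace ℝ (Fin m) → ℝ)
    (x : EuclideanSpace ℝ (Fin m)) (r : ℝ) : ℝ :=
  (sphereArea m r)⁻¹ * sphereIntegral (normalDeriv u x r) x r

/-- The ball `B_r(x)` is admissible for `D` when its closure lies in `D`. -/
def Admissible {m : ℕ} (D : Set (EuclideanSpace ℝ (Fin m)))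
    (x : EuclideanSpace ℝ (Fin m)) (r : ℝ) : Prop :=
  0 < r ∧ closure (ball x r) ⊆ D

/-- A real-valued `u` is metaharmonic in the open set `D` with parameter `lam ∈ ℂ` when it is
`C²` in `D` and solves the Helmholtz equation `∇²u + lam² u = 0` there. -/
def Metaharmonic {m : ℕ} (lam : ℂ) (u : EuclideanSpace ℝ (Fin m) → ℝ)
    (D : Set (EuclideanSpace ℝ (Fin m))) : Prop :=
  ContDiffOn ℝ 2 u D ∧
    ∀ x ∈ D, ((Laplacian.laplacian u x : ℝ) : ℂ) + lam ^ 2 * ((u x : ℝ) : ℂ) = 0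

end

noncomputable section

open Filter Topology

/-! As r → 0 the ball means tend to u(x), so m F(u,x,r)/r tends to -λ² u(x). Only this pointwise
limit is needed, so r(x) may vary without any uniformity. If λ² is not real, imaginary parts force u
= 0. Otherwise put k = λ²: then u is a C¹ function whose Laplacian, read off from small fluxes
(`HasFluxLaplacian`), is -k u. For C² functions this limit is the true Laplacian
(`tendsto_flux_of_contDiffAt`), so what is missing is that u is C².

Regularity comes from a mean value property: locally M°(u,x,t) = a(t) u(x) with a independent of x,
so where a(t) ≠ 0 the function u is a multiple of M°(u,·,t), which is C² by hypothesis. The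
division-free form u(y) M°(u,x,t) = u(x) M°(u,y,t) is `sphInt_mul_eq`. For a smooth solution both
sides satisfy the same radial equation with the same initial value. Since u is only C¹, it is
replaced by a smooth q with u - q and Δq + k u uniformly small (`exists_smooth_approx`), and a
Grönwall-type bound (`abs_sphInt_comb_le`) lets the error tend to zero.

To build q, approximate u by a polynomial p and solve Δq = -k p with q = p on the sphere, which is
possible within polynomials (`exists_polyLaplacian_eq`). A maximum principle that needs only flux
Laplacians (`abs_le_of_fluxLaplacian`) then controls u - q. -/

/-- Euclidean space of dimension `m`. -/
abbrev Euc (m : ℕ) := EuclideanSpace ℝ (Fin m)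

/-- The surface measure of the unit sphere. -/
abbrev surfaceMeasure (m : ℕ) : Measure (sphere (0 : Euc m) 1) :=
  (volume : Measure (Euc m)).toSphere

/-- The area of the unit sphere. -/
def unitArea (m : ℕ) : ℝ := (surfaceMeasure m).real univ

/-- The integral of `θ ↦ f (x + r θ)` over the unit sphere. -/
def sphInt {m : ℕ} (f : Euc m → ℝ) (x : Euc m) (r : ℝ) : ℝ :=
  ∫ θ : sphere (0 : Euc m) 1, f (x + r • (θ : Euc m)) ∂surfaceMeasure m

/-- The integral of the radial derivative of `f` over the unit sphere. -/
def sphFlux {m : ℕ} (f : Euc m → ℝ) (x : Euc m) (r : ℝ) : ℝ :=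
  ∫ θ : sphere (0 : Euc m) 1, fderiv ℝ f (x + r • (θ : Euc m)) θ ∂surfaceMeasure m

variable {m : ℕ}

/-! ### Normalisation of means by the area of the unit sphere -/

lemma unitArea_eq : unitArea m = m * (volume : Measure (Euc m)).real (ball 0 1) := by
  simp [unitArea]

lemma unitArea_pos (hm : 2 ≤ m) : 0 < unitArea m := by
  rw [unitArea_eq]
  have : 0 < (volume : Measure (Euc m)).real (ball 0 1) :=
    ENNReal.toReal_pos (measure_ball_pos _ _ one_pos).ne' measure_ball_lt_top.ne
  have : (0 : ℝ) < m := by positivity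
  positivity

lemma unitArea_eq_gamma (hm : 2 ≤ m) :
    unitArea m = 2 * Real.pi ^ ((m : ℝ) / 2) / Real.Gamma ((m : ℝ) / 2) := by
  have : Nonempty (Fin m) := ⟨⟨0, by omega⟩⟩
  have hm0 : (0 : ℝ) < m := by positivity
  rw [unitArea_eq, measureReal_def, EuclideanSpace.volume_ball,
    Real.Gamma_add_one (by simp; positivity)]
  have h1 : √Real.pi ^ m = Real.pi ^ ((m : ℝ) / 2) := by
    rw [Real.sqrt_eq_rpow, ← Real.rpow_natCast, ← Real.rpow_mul Real.pi_pos.le]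
    congr 1; ring
  have hg : 0 < Real.Gamma ((m : ℝ) / 2) := Real.Gamma_pos_of_pos (by positivity)
  simp only [Fintype.card_fin, ENNReal.ofReal_one, one_pow, one_mul, h1]
  rw [ENNReal.toReal_ofReal (by positivity)]
  field_simp

lemma sphereArea_eq (hm : 2 ≤ m) (r : ℝ) : sphereArea m r = unitArea m * r ^ (m - 1) := by
  rw [sphereArea, unitArea_eq_gamma hm]; ring

lemma sphereMean_eq (hm : 2 ≤ m) (f : Euc m → ℝ) (x : Euc m) {r : ℝ} (hr : 0 < r) :
    sphereMean f x r = (unitArea m)⁻¹ * sphInt f x r := by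
  have := unitArea_pos hm
  have : 0 < r ^ (m - 1) := by positivity
  rw [sphereMean, sphereArea_eq hm, sphereIntegral, sphInt]
  field_simp

lemma meanFlux_eq (hm : 2 ≤ m) (f : Euc m → ℝ) (x : Euc m) {r : ℝ} (hr : 0 < r) :
    meanFlux f x r = (unitArea m)⁻¹ * sphFlux f x r := by
  have := unitArea_pos hm
  have : 0 < r ^ (m - 1) := by positivity
  have h : ∀ θ : sphere (0 : Euc m) 1, normalDeriv f x r (x + r • (θ : Euc m))
      = fderiv ℝ f (x + r • (θ : Euc m)) θ := fun θ => by
    simp [normalDeriv, smul_smul, hr.ne']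
  rw [meanFlux, sphereArea_eq hm, sphereIntegral, sphFlux]
  simp only [h]
  field_simp

/-! ### Spherical and ball means as functions of the radius -/

lemma norm_unitSphere (θ : sphere (0 : Euc m) 1) : ‖(θ : Euc m)‖ = 1 := by simp

lemma sphInt_zero (f : Euc m → ℝ) (x : Euc m) : sphInt f x 0 = unitArea m * f x := by
  simp [sphInt, unitArea]

lemma add_smul_mem_ball (x : Euc m) {r R : ℝ} (hr : |r| < R) (θ : sphere (0 : Euc m) 1) :
    x + r • (θ : Euc m) ∈ ball x R := by
  simp [norm_smul, hr]

lemma add_smul_mem_closedBall (x : Euc m) {r R : ℝ} (hr : |r| ≤ R) (θ : sphere (0 : Euc m) 1) :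
    x + r • (θ : Euc m) ∈ closedBall x R := by
  simp [norm_smul, hr]

lemma continuous_sphere_comp {F : Type*} [TopologicalSpace F] {f : Euc m → F} {x : Euc m}
    {r R : ℝ} (hf : ContinuousOn f (closedBall x R)) (hr : |r| ≤ R) :
    Continuous fun θ : sphere (0 : Euc m) 1 => f (x + r • (θ : Euc m)) :=
  hf.comp_continuous (by fun_prop) fun θ => add_smul_mem_closedBall x hr θ

lemma integrable_sphere {F : Type*} [NormedAddCommGroup F] {f : sphere (0 : Euc m) 1 → F}
    (hf : Continuous f) : Integrable f (surfaceMeasure m) :=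
  hf.integrable_of_hasCompactSupport (HasCompactSupport.of_compactSpace _)

lemma continuousOn_fderiv {f : Euc m → ℝ} {x : Euc m} {R : ℝ}
    (hf : ContDiffOn ℝ 1 f (ball x R)) : ContinuousOn (fderiv ℝ f) (ball x R) :=
  hf.continuousOn_fderiv_of_isOpen isOpen_ball le_rfl

lemma continuous_flux_integrand {f : Euc m → ℝ} {x : Euc m} {r R : ℝ}
    (hf : ContDiffOn ℝ 1 f (ball x R)) (hr : |r| < R) :
    Continuous fun θ : sphere (0 : Euc m) 1 => fderiv ℝ f (x + r • (θ : Euc m)) θ := by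
  have h := continuous_sphere_comp
    ((continuousOn_fderiv hf).mono (closedBall_subset_ball hr)) le_rfl
  exact h.clm_apply continuous_subtype_val

lemma hasDerivAt_sphInt {f : Euc m → ℝ} {x : Euc m} {r R : ℝ}
    (hf : ContDiffOn ℝ 1 f (ball x R)) (hr : |r| < R) :
    HasDerivAt (sphInt f x) (sphFlux f x r) r := by
  -- The intermediate radius makes the closed ball compact inside the domain of smoothness, so the
  -- gradient has a bound to dominate with.
  obtain ⟨R', h1, h2⟩ := exists_between hr
  have hfd := (continuousOn_fderiv hf).mono (closedBall_subset_ball h2)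
  obtain ⟨C, hC⟩ := (isCompact_closedBall x R').exists_bound_of_continuousOn hfd
  have hs : Ioo (-R') R' ∈ 𝓝 r := Ioo_mem_nhds (abs_lt.1 h1).1 (abs_lt.1 h1).2
  have hcont : ∀ t : ℝ, |t| < R' →
      Continuous fun θ : sphere (0 : Euc m) 1 => f (x + t • (θ : Euc m)) := fun t ht =>
    continuous_sphere_comp (hf.continuousOn.mono (closedBall_subset_ball h2)) ht.le
  refine (hasDerivAt_integral_of_dominated_loc_of_deriv_le (μ := surfaceMeasure m)
    (F := fun t θ => f (x + t • (θ : Euc m)))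
    (F' := fun t θ => fderiv ℝ f (x + t • (θ : Euc m)) θ) (bound := fun _ => C) hs ?_ ?_ ?_ ?_
    (integrable_const _) ?_).2
  · filter_upwards [hs] with t ht
    exact (hcont t (abs_lt.2 ht)).aestronglyMeasurable
  · exact integrable_sphere (hcont r h1)
  · exact (continuous_flux_integrand hf hr).aestronglyMeasurable
  · refine Eventually.of_forall fun θ t ht => ?_
    refine (ContinuousLinearMap.le_opNorm _ _).trans ?_
    rw [norm_unitSphere, mul_one]
    exact hC _ (add_smul_mem_closedBall x (abs_lt.2 ht).le θ)
  · refine Eventually.of_forall fun θ t ht => ?_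
    have hmem := add_smul_mem_ball x ((abs_lt.2 ht).trans h2) θ
    have hd := ((hf.contDiffAt (isOpen_ball.mem_nhds hmem)).differentiableAt
      one_ne_zero).hasFDerivAt
    have hl : HasDerivAt (fun t : ℝ => x + t • (θ : Euc m)) (θ : Euc m) t := by
      simpa using ((hasDerivAt_id t).smul_const (θ : Euc m)).const_add x
    exact hd.comp_hasDerivAt t hl

lemma continuous_sphInt {f : Euc m → ℝ} (hf : Continuous f) (x : Euc m) :
    Continuous (sphInt f x) := by
  have := continuous_parametric_integral_of_continuous (μ := surfaceMeasure m)
    (f := fun (r : ℝ) (θ : sphere (0 : Euc m) 1) => f (x + r • (θ : Euc m)))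
    (by fun_prop) isCompact_univ
  simp only [Measure.restrict_univ] at this
  exact this

lemma continuous_sphFlux {f : Euc m → ℝ} (hf : ContDiff ℝ 1 f) (x : Euc m) :
    Continuous (sphFlux f x) := by
  have h' := hf.continuous_fderiv one_ne_zero
  have := continuous_parametric_integral_of_continuous (μ := surfaceMeasure m)
    (f := fun (r : ℝ) (θ : sphere (0 : Euc m) 1) => fderiv ℝ f (x + r • (θ : Euc m)) θ)
    (by simp only [Function.uncurry_def]; fun_prop) isCompact_univ
  simp only [Measure.restrict_univ] at this
  exact this

lemma tendsto_ballMean {f : Euc m → ℝ} {x : Euc m} {R : ℝ} (hR : 0 < R)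
    (hf : ContinuousOn f (closedBall x R)) :
    Tendsto (ballMean f x) (𝓝[>] 0) (𝓝 (f x)) := by
  rw [Metric.tendsto_nhdsWithin_nhds]
  intro ε hε
  have hc : ContinuousAt f x := hf.continuousAt (closedBall_mem_nhds x hR)
  obtain ⟨δ, hδ, hd⟩ := Metric.continuousAt_iff.1 hc (ε / 2) (half_pos hε)
  refine ⟨min δ R, lt_min hδ hR, fun {r} hr hrd => ?_⟩
  have hr0 : (0 : ℝ) < r := hr
  simp only [Real.dist_eq, sub_zero, abs_of_pos hr0] at hrd
  have hrδ := hrd.trans_le (min_le_left _ _)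
  have hrR := hrd.trans_le (min_le_right _ _)
  have hv : 0 < (volume : Measure (Euc m)).real (ball x r) :=
    ENNReal.toReal_pos (measure_ball_pos _ _ hr0).ne' measure_ball_lt_top.ne
  have hi : IntegrableOn f (ball x r) :=
    (hf.integrableOn_compact (isCompact_closedBall x R)).mono_set
      (ball_subset_closedBall.trans (closedBall_subset_closedBall hrR.le))
  have hb : ‖∫ y in ball x r, (f y - f x)‖ ≤ ε / 2 * (volume : Measure (Euc m)).real (ball x r) :=
    norm_setIntegral_le_of_norm_le_const measure_ball_lt_top fun y hy =>
      (hd ((mem_ball.1 hy).trans hrδ)).le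
  rw [integral_sub hi (integrableOn_const measure_ball_lt_top.ne)] at hb
  rw [setIntegral_const, smul_eq_mul, Real.norm_eq_abs] at hb
  set v := (volume : Measure (Euc m)).real (ball x r)
  have key : ballMean f x r - f x = v⁻¹ * ((∫ y in ball x r, f y) - v * f x) := by
    have h : ballMean f x r = v⁻¹ * ∫ y in ball x r, f y := rfl
    rw [h]; field_simp
  rw [Real.dist_eq, key, abs_mul, abs_of_pos (inv_pos.2 hv)]
  calc v⁻¹ * |(∫ y in ball x r, f y) - v * f x| ≤ v⁻¹ * (ε / 2 * v) := by gcongr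
    _ = ε / 2 := by field_simp
    _ < ε := half_lt_self hε

/-! ### Polar coordinates and the divergence theorem on balls -/

lemma integral_polar (hm : 2 ≤ m) {f : Euc m → ℝ} (hf : Integrable f) :
    ∫ y, f y = ∫ s in Ioi (0 : ℝ), s ^ (m - 1) * sphInt f 0 s := by
  have : Nontrivial (Euc m) := by
    have : Nonempty (Fin m) := ⟨⟨0, by omega⟩⟩
    infer_instance
  have hmp := (volume : Measure (Euc m)).measurePreserving_homeomorphUnitSphereProd
  have hemb := (homeomorphUnitSphereProd (Euc m)).measurableEmbedding
  set g : sphere (0 : Euc m) 1 × Ioi (0 : ℝ) → ℝ := fun p => f ((p.2 : ℝ) • (p.1 : Euc m)) with hg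
  have hcomp : g ∘ homeomorphUnitSphereProd (Euc m)
      = fun x : ({0}ᶜ : Set (Euc m)) => f x := by
    ext ⟨x, hx⟩
    have hx' : ‖x‖ ≠ 0 := by simpa using hx
    simp [hg, smul_smul, hx']
  have hint : Integrable g
      (((volume : Measure (Euc m)).toSphere).prod
        (Measure.volumeIoiPow (Module.finrank ℝ (Euc m) - 1))) := by
    rw [← hmp.integrable_comp_emb hemb, hcomp]
    exact (MeasurableEmbedding.subtype_coe
      (measurableSet_singleton _).compl).integrableOn_range_iff_comap.1 hf.integrableOn
  calc ∫ y, f y = ∫ x : ({0}ᶜ : Set (Euc m)), f x ∂(Measure.comap Subtype.val volume) := by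
        rw [integral_subtype_comap (measurableSet_singleton _).compl f,
          restrict_compl_singleton]
    _ = ∫ p, g p ∂(((volume : Measure (Euc m)).toSphere).prod
        (Measure.volumeIoiPow (Module.finrank ℝ (Euc m) - 1))) := by
        rw [← hmp.integral_comp hemb g]
        exact congrArg (fun h => ∫ x, h x ∂(Measure.comap Subtype.val volume)) hcomp.symm
    _ = ∫ s : Ioi (0 : ℝ), sphInt f 0 s
          ∂(Measure.volumeIoiPow (Module.finrank ℝ (Euc m) - 1)) := by
        rw [integral_prod_symm _ hint]
        simp [hg, sphInt]
    _ = _ := by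
        simp only [Measure.volumeIoiPow, ENNReal.ofReal]
        rw [integral_withDensity_eq_integral_smul,
          integral_subtype_comap measurableSet_Ioi
            fun a ↦ Real.toNNReal (a ^ (Module.finrank ℝ (Euc m) - 1)) • sphInt f 0 a,
          setIntegral_congr_fun measurableSet_Ioi fun x hx ↦ ?_]
        · rw [NNReal.smul_def, Real.coe_toNNReal _ (pow_nonneg hx.out.le _), finrank_euclideanSpace,
            Fintype.card_fin, smul_eq_mul]
        · exact (measurable_subtype_coe.pow_const _).real_toNNReal

/-- Squaring smooths the kink of the positive part. Hence (R² - |y|²)₊² is differentiable everywhere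
and compactly supported, and integration by parts over the whole space has no boundary term. -/
lemma hasDerivAt_max_zero_sq (t : ℝ) :
    HasDerivAt (fun t : ℝ => max t 0 ^ 2) (2 * max t 0) t := by
  rcases lt_trichotomy t 0 with h | h | h
  · rw [max_eq_right h.le, mul_zero]
    refine (hasDerivAt_const t (0 : ℝ)).congr_of_eventuallyEq ?_
    filter_upwards [Iio_mem_nhds h] with s hs
    simp [max_eq_right (le_of_lt (show s < 0 from hs))]
  · subst h
    rw [hasDerivAt_iff_isLittleO]
    have h2 : (fun x : ℝ => x ^ 2) =o[𝓝 0] fun x => x := by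
      simpa using Asymptotics.isLittleO_pow_id (𝕜 := ℝ) one_lt_two
    refine (Asymptotics.IsBigO.trans_isLittleO (Asymptotics.isBigO_of_le _ fun x => ?_) h2).congr
      (fun x => rfl) (fun x => by simp)
    rcases le_total x 0 with hx | hx <;> simp [hx, sq_nonneg]
  · rw [max_eq_left h.le]
    have := (hasDerivAt_id t).pow 2
    simp only [id, Nat.cast_ofNat, Nat.add_one_sub_one, pow_one, mul_one] at this
    refine this.congr_of_eventuallyEq ?_
    filter_upwards [Ioi_mem_nhds h] with s hs
    simp [max_eq_left (le_of_lt (show 0 < s from hs))]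

lemma laplacian_eq_sum (f : Euc m → ℝ) (x : Euc m) :
    Laplacian.laplacian f x = ∑ i, fderiv ℝ (fderiv ℝ f) x (EuclideanSpace.basisFun (Fin m) ℝ i)
      (EuclideanSpace.basisFun (Fin m) ℝ i) := by
  rw [InnerProductSpace.laplacian_eq_iteratedFDeriv_orthonormalBasis f
    (EuclideanSpace.basisFun (Fin m) ℝ)]
  simp [iteratedFDeriv_two_apply]

lemma continuous_laplacian {f : Euc m → ℝ} (hf : ContDiff ℝ 2 f) :
    Continuous (Laplacian.laplacian f) := by
  have : Continuous (fderiv ℝ (fderiv ℝ f)) :=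
    (hf.fderiv_right (m := 1) le_rfl).continuous_fderiv one_ne_zero
  rw [show Laplacian.laplacian f = _ from funext (laplacian_eq_sum f)]
  fun_prop

lemma integrable_max_mul {g : Euc m → ℝ} (hg : Continuous g) (R : ℝ) :
    Integrable fun y : Euc m => max (R ^ 2 - ‖y‖ ^ 2) 0 * g y := by
  refine Continuous.integrable_of_hasCompactSupport (by fun_prop) ?_
  refine HasCompactSupport.intro (isCompact_closedBall (0 : Euc m) |R|) fun y hy => ?_
  rw [mem_closedBall_zero_iff, not_le] at hy
  have : R ^ 2 - ‖y‖ ^ 2 ≤ 0 := by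
    have := sq_lt_sq' (by linarith [abs_nonneg R, norm_nonneg y]) hy
    rw [sq_abs] at this; linarith
  simp [max_eq_right this]

/-- Integration by parts against the cut-off `(R² - |y|²)₊²`. -/
lemma integral_cutoff_laplacian {q : Euc m → ℝ} (hq : ContDiff ℝ 2 q) (x : Euc m) (R : ℝ) :
    ∫ y, max (R ^ 2 - ‖y‖ ^ 2) 0 ^ 2 * Laplacian.laplacian q (x + y)
      = ∫ y, 4 * (max (R ^ 2 - ‖y‖ ^ 2) 0 * fderiv ℝ q (x + y) y) := by
  set e := EuclideanSpace.basisFun (Fin m) ℝ with he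
  have hd1 : ContDiff ℝ 1 (fderiv ℝ q) := hq.fderiv_right (m := 1) le_rfl
  have hc1 : Continuous (fderiv ℝ q) := hd1.continuous
  have hc2 : Continuous (fderiv ℝ (fderiv ℝ q)) := hd1.continuous_fderiv one_ne_zero
  have hψ : ∀ y : Euc m, HasFDerivAt (fun y : Euc m => max (R ^ 2 - ‖y‖ ^ 2) 0 ^ 2)
      ((2 * max (R ^ 2 - ‖y‖ ^ 2) 0) • (-(2 • innerSL ℝ y) : Euc m →L[ℝ] ℝ)) y := fun y =>
    (hasDerivAt_max_zero_sq (R ^ 2 - ‖y‖ ^ 2)).comp_hasFDerivAt (f := fun y => R ^ 2 - ‖y‖ ^ 2) y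
      (((hasStrictFDerivAt_norm_sq y).hasFDerivAt).const_sub (R ^ 2))
  have hg : ∀ i, ∀ y : Euc m, HasFDerivAt (fun y : Euc m => fderiv ℝ q (x + y) (e i))
      ((fderiv ℝ (fderiv ℝ q) (x + y)).flip (e i)) y := fun i y => by
    have h1 : HasFDerivAt (fun y : Euc m => fderiv ℝ q (x + y))
        (fderiv ℝ (fderiv ℝ q) (x + y)) y := by
      have := ((hd1.differentiable one_ne_zero) (x + y)).hasFDerivAt.comp y
        ((hasFDerivAt_id y).const_add x)
      rw [ContinuousLinearMap.comp_id] at this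
      exact this
    simpa using h1.clm_apply (hasFDerivAt_const (e i) y)
  have hparts : ∀ i, ∫ y : Euc m, max (R ^ 2 - ‖y‖ ^ 2) 0 ^ 2 * fderiv ℝ (fderiv ℝ q) (x + y) (e i) (e i)
      = ∫ y : Euc m, 4 * (max (R ^ 2 - ‖y‖ ^ 2) 0 * (fderiv ℝ q (x + y) (y i • e i))) := fun i => by
    have := integral_bilinear_hasFDerivAt_right_eq_neg_left_of_integrable (μ := volume)
      (B := ContinuousLinearMap.mul ℝ ℝ) (v := e i)
      (f := fun y : Euc m => max (R ^ 2 - ‖y‖ ^ 2) 0 ^ 2)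
      (f' := fun y => (2 * max (R ^ 2 - ‖y‖ ^ 2) 0) • (-(2 • innerSL ℝ y) : Euc m →L[ℝ] ℝ))
      (g := fun y => fderiv ℝ q (x + y) (e i))
      (g' := fun y => (fderiv ℝ (fderiv ℝ q) (x + y)).flip (e i)) ?_ ?_ ?_
      (fun y _ => hψ y) (fun y _ => hg i y)
    · simp only [ContinuousLinearMap.mul_apply', ContinuousLinearMap.flip_apply] at this
      rw [this, ← integral_neg]
      congr 1; ext y
      simp [he, EuclideanSpace.inner_single_right]
      ring
    · have := integrable_max_mul (g := fun y : Euc m => (-4 * inner ℝ y (e i)) *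
        fderiv ℝ q (x + y) (e i)) (by fun_prop) R
      refine this.congr (Eventually.of_forall fun y => ?_)
      simp; ring
    · have := integrable_max_mul (g := fun y : Euc m => max (R ^ 2 - ‖y‖ ^ 2) 0 *
        fderiv ℝ (fderiv ℝ q) (x + y) (e i) (e i)) (by fun_prop) R
      refine this.congr (Eventually.of_forall fun y => ?_)
      simp; ring
    · have := integrable_max_mul (g := fun y : Euc m => max (R ^ 2 - ‖y‖ ^ 2) 0 *
        fderiv ℝ q (x + y) (e i)) (by fun_prop) R
      refine this.congr (Eventually.of_forall fun y => ?_)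
      simp; ring
  have hy : ∀ y : Euc m, y = ∑ i, y i • e i := fun y => by
    simpa [he] using (e.sum_repr y).symm
  calc _ = ∫ y, ∑ i, max (R ^ 2 - ‖y‖ ^ 2) 0 ^ 2 *
        fderiv ℝ (fderiv ℝ q) (x + y) (e i) (e i) := by
        congr 1; ext y; rw [laplacian_eq_sum, Finset.mul_sum]
    _ = ∑ i, ∫ y, max (R ^ 2 - ‖y‖ ^ 2) 0 ^ 2 *
        fderiv ℝ (fderiv ℝ q) (x + y) (e i) (e i) := by
        refine integral_finsetSum _ fun i _ => ?_
        have := integrable_max_mul (g := fun y : Euc m => max (R ^ 2 - ‖y‖ ^ 2) 0 *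
          fderiv ℝ (fderiv ℝ q) (x + y) (e i) (e i)) (by fun_prop) R
        refine this.congr (Eventually.of_forall fun y => ?_)
        simp; ring
    _ = ∑ i, ∫ y : Euc m, 4 * (max (R ^ 2 - ‖y‖ ^ 2) 0 * (fderiv ℝ q (x + y) (y i • e i))) :=
        Finset.sum_congr rfl fun i _ => hparts i
    _ = ∫ y : Euc m, ∑ i, 4 * (max (R ^ 2 - ‖y‖ ^ 2) 0 * (fderiv ℝ q (x + y) (y i • e i))) := by
        refine (integral_finsetSum _ fun i _ => ?_).symm
        exact (integrable_max_mul (by fun_prop) R).const_mul 4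
    _ = _ := by
        congr 1; ext y
        rw [← Finset.mul_sum, ← Finset.mul_sum, ← map_sum, ← hy y]

/-- A continuous primitive is determined by its moments against the cut-offs. -/
lemma primitive_eq_of_cutoff_moments {G Φ : ℝ → ℝ} (hG : Continuous G) (hΦ : Continuous Φ)
    (h : ∀ R > 0, ∫ s in (0 : ℝ)..R, (R ^ 2 - s ^ 2) ^ 2 * G s
      = ∫ s in (0 : ℝ)..R, 4 * ((R ^ 2 - s ^ 2) * (s * Φ s))) {R : ℝ} (hR : 0 < R) :
    ∫ s in (0 : ℝ)..R, G s = Φ R := by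
  set H : ℝ → ℝ := fun s => ∫ t in (0 : ℝ)..s, G t with hH
  have hHd : ∀ s, HasDerivAt H (G s) s := fun s =>
    (hG.integral_hasStrictDerivAt 0 s).hasDerivAt
  have hHc : Continuous H := continuous_iff_continuousAt.2 fun s => (hHd s).continuousAt
  set D : ℝ → ℝ := fun s => s * (H s - Φ s) with hD
  have hDc : Continuous D := by fun_prop
  -- Integrating the left side of `h` by parts moves the derivative onto the weight, and the
  -- boundary terms vanish at both ends. What remains is the moment of `D` against R² - s².
  have hmom : ∀ R > 0, R ^ 2 * (∫ s in (0 : ℝ)..R, D s) - ∫ s in (0 : ℝ)..R, s ^ 2 * D s = 0 := by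
    intro R hR
    have hparts := intervalIntegral.integral_mul_deriv_eq_deriv_mul (a := 0) (b := R)
      (u := fun s => (R ^ 2 - s ^ 2) ^ 2) (u' := fun s => -(4 * ((R ^ 2 - s ^ 2) * s)))
      (v := H) (v' := G) (fun s _ => by
        have := ((hasDerivAt_pow 2 s).const_sub (R ^ 2)).fun_pow 2
        convert this using 1
        push_cast; ring) (fun s _ => hHd s)
      (Continuous.intervalIntegrable (by fun_prop) _ _) (hG.intervalIntegrable _ _)
    have hH0 : H 0 = 0 := by simp [hH]
    rw [h R hR, hH0] at hparts
    have hi : ∀ f : ℝ → ℝ, Continuous f → IntervalIntegrable f volume 0 R := fun f hf =>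
      hf.intervalIntegrable _ _
    rw [← intervalIntegral.integral_const_mul, ← intervalIntegral.integral_sub
      (hi _ (by fun_prop)) (hi _ (by fun_prop))]
    have h4 : (∫ s in (0 : ℝ)..R, 4 * ((R ^ 2 - s ^ 2) * (s * Φ s)))
        + ∫ s in (0 : ℝ)..R, -(4 * ((R ^ 2 - s ^ 2) * s)) * H s = 0 := by
      rw [hparts]; ring
    rw [← intervalIntegral.integral_add (hi _ (by fun_prop)) (hi _ (by fun_prop))] at h4
    have : ∫ s in (0 : ℝ)..R, (R ^ 2 * D s - s ^ 2 * D s)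
        = (-1 / 4) * ∫ s in (0 : ℝ)..R, (4 * ((R ^ 2 - s ^ 2) * (s * Φ s))
          + -(4 * ((R ^ 2 - s ^ 2) * s)) * H s) := by
      rw [← intervalIntegral.integral_const_mul]
      congr 1; ext s; simp only [hD]; ring
    rw [this, h4, mul_zero]
  have hDd : ∀ s, HasDerivAt (fun s => ∫ t in (0 : ℝ)..s, D t) (D s) s := fun s =>
    (hDc.integral_hasStrictDerivAt 0 s).hasDerivAt
  -- Differentiating `hmom` in R, the two terms R² D(R) cancel and 2R ∫ D = 0 is left. One more
  -- derivative gives D(R) = 0.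
  have hA : ∀ R > 0, ∫ s in (0 : ℝ)..R, D s = 0 := by
    intro R hR
    have hc2 : Continuous fun s => s ^ 2 * D s := by fun_prop
    have h1 := (((hasDerivAt_id R).pow 2).mul (hDd R)).sub
      (hc2.integral_hasStrictDerivAt 0 R).hasDerivAt
    have h2 := h1.unique ((hasDerivAt_const R (0 : ℝ)).congr_of_eventuallyEq (by
      filter_upwards [Ioi_mem_nhds hR] with s hs
      simpa using hmom s hs))
    simp at h2
    exact h2.resolve_left hR.ne'
  have hDR := (hDd R).unique ((hasDerivAt_const R (0 : ℝ)).congr_of_eventuallyEq (by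
      filter_upwards [Ioi_mem_nhds hR] with s hs
      exact hA s hs))
  have := (mul_eq_zero.1 hDR).resolve_left hR.ne'
  linarith

lemma integral_Ioi_max_mul {f : ℝ → ℝ} {R : ℝ} (hR : 0 < R) :
    ∫ s in Ioi (0 : ℝ), max (R ^ 2 - s ^ 2) 0 * f s
      = ∫ s in (0 : ℝ)..R, (R ^ 2 - s ^ 2) * f s := by
  rw [intervalIntegral.integral_of_le hR.le,
    setIntegral_eq_of_subset_of_forall_sdiff_eq_zero measurableSet_Ioi Ioc_subset_Ioi_self]
  · refine setIntegral_congr_fun measurableSet_Ioc fun s hs => ?_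
    have : 0 ≤ R ^ 2 - s ^ 2 := by nlinarith [hs.1, hs.2]
    simp only [max_eq_left this]
  · intro s hs
    have h0 : 0 < s := hs.1
    have h1 : R < s := by
      by_contra hc
      exact hs.2 ⟨h0, not_lt.1 hc⟩
    have : R ^ 2 - s ^ 2 ≤ 0 := by nlinarith
    simp [max_eq_right this]

/-- The divergence theorem for a gradient field on a ball, in polar coordinates. -/
theorem sphFlux_eq_integral_laplacian (hm : 2 ≤ m) {q : Euc m → ℝ} (hq : ContDiff ℝ 2 q)
    (x : Euc m) {R : ℝ} (hR : 0 < R) :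
    ∫ s in (0 : ℝ)..R, s ^ (m - 1) * sphInt (Laplacian.laplacian q) x s
      = R ^ (m - 1) * sphFlux q x R := by
  have hΔ := continuous_laplacian hq
  have hq1 : ContDiff ℝ 1 q := hq.of_le one_le_two
  have hd : Continuous (fderiv ℝ q) := hq1.continuous_fderiv one_ne_zero
  have hcI := continuous_sphInt hΔ x
  have hcF := continuous_sphFlux hq1 x
  refine primitive_eq_of_cutoff_moments (Φ := fun s => s ^ (m - 1) * sphFlux q x s)
    (by fun_prop) (by fun_prop) (fun R hR => ?_) hR
  have h1 : Integrable fun y : Euc m =>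
      max (R ^ 2 - ‖y‖ ^ 2) 0 ^ 2 * Laplacian.laplacian q (x + y) := by
    have := integrable_max_mul (g := fun y : Euc m => max (R ^ 2 - ‖y‖ ^ 2) 0 *
        Laplacian.laplacian q (x + y)) (by fun_prop) R
    refine this.congr (Eventually.of_forall fun y => ?_)
    simp only; ring
  have h2 : Integrable fun y : Euc m =>
      4 * (max (R ^ 2 - ‖y‖ ^ 2) 0 * fderiv ℝ q (x + y) y) :=
    (integrable_max_mul (by fun_prop) R).const_mul 4
  have h3 := integral_cutoff_laplacian hq x R
  rw [integral_polar hm h1, integral_polar hm h2] at h3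
  have e1 : ∀ s : ℝ, s ^ (m - 1) * sphInt (fun y : Euc m =>
      max (R ^ 2 - ‖y‖ ^ 2) 0 ^ 2 * Laplacian.laplacian q (x + y)) 0 s
      = max (R ^ 2 - s ^ 2) 0 * (max (R ^ 2 - s ^ 2) 0 * (s ^ (m - 1) *
        sphInt (Laplacian.laplacian q) x s)) := fun s => by
    have : sphInt (fun y : Euc m =>
      max (R ^ 2 - ‖y‖ ^ 2) 0 ^ 2 * Laplacian.laplacian q (x + y)) 0 s
      = max (R ^ 2 - s ^ 2) 0 ^ 2 * sphInt (Laplacian.laplacian q) x s := by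
      simp only [sphInt]
      rw [← integral_const_mul]
      simp [norm_smul]
    rw [this]; ring
  have e2 : ∀ s : ℝ, s ^ (m - 1) * sphInt (fun y : Euc m =>
      4 * (max (R ^ 2 - ‖y‖ ^ 2) 0 * fderiv ℝ q (x + y) y)) 0 s
      = max (R ^ 2 - s ^ 2) 0 * (4 * (s * (s ^ (m - 1) * sphFlux q x s))) := fun s => by
    have : sphInt (fun y : Euc m =>
      4 * (max (R ^ 2 - ‖y‖ ^ 2) 0 * fderiv ℝ q (x + y) y)) 0 s
      = 4 * (max (R ^ 2 - s ^ 2) 0 * (s * sphFlux q x s)) := by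
      simp only [sphInt, sphFlux]
      rw [← integral_const_mul, ← integral_const_mul, ← integral_const_mul]
      simp [norm_smul]
    rw [this]; ring
  rw [setIntegral_congr_fun measurableSet_Ioi fun s _ => e1 s,
    setIntegral_congr_fun measurableSet_Ioi fun s _ => e2 s] at h3
  rw [integral_Ioi_max_mul hR, integral_Ioi_max_mul hR] at h3
  calc _ = ∫ s in (0 : ℝ)..R, (R ^ 2 - s ^ 2) * (max (R ^ 2 - s ^ 2) 0 * (s ^ (m - 1) *
        sphInt (Laplacian.laplacian q) x s)) := by
        refine intervalIntegral.integral_congr fun s hs => ?_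
        rw [uIcc_of_le hR.le] at hs
        have : 0 ≤ R ^ 2 - s ^ 2 := by nlinarith [hs.1, hs.2]
        simp only [max_eq_left this]; ring
    _ = _ := by
        rw [h3]
        refine intervalIntegral.integral_congr fun s _ => ?_
        ring

/-! ### Moments of the sphere and the Laplacian as a limit of fluxes -/

/-- A linear form is harmonic and equals its own radial derivative on the unit sphere, so the
divergence theorem applies. -/
lemma integral_sphere_clm (hm : 2 ≤ m) (L : Euc m →L[ℝ] ℝ) :
    ∫ θ : sphere (0 : Euc m) 1, L θ ∂surfaceMeasure m = 0 := by
  have h := sphFlux_eq_integral_laplacian hm (q := L) L.contDiff 0 one_pos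
  have h1 : Laplacian.laplacian (L : Euc m → ℝ) = 0 := by
    have hd : fderiv ℝ (L : Euc m → ℝ) = fun _ => L := funext fun y => L.fderiv
    ext x; rw [laplacian_eq_sum, hd]; simp
  have h2 : sphFlux (L : Euc m → ℝ) 0 1 = ∫ θ : sphere (0 : Euc m) 1, L θ ∂surfaceMeasure m := by
    simp [sphFlux]
  rw [h1, h2] at h
  simpa [sphInt] using h.symm

/-- The function B(y, y) has constant Laplacian 2 tr B and radial derivative 2 B(θ, θ) on the unit
sphere. The divergence theorem on the unit ball compares them, the factor m coming from ∫₀¹ s^(m-1)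
ds = 1/m. -/
lemma integral_sphere_quadratic (hm : 2 ≤ m) (B : Euc m →L[ℝ] Euc m →L[ℝ] ℝ) :
    m * ∫ θ : sphere (0 : Euc m) 1, B θ θ ∂surfaceMeasure m
      = unitArea m * ∑ i, B (EuclideanSpace.basisFun (Fin m) ℝ i)
        (EuclideanSpace.basisFun (Fin m) ℝ i) := by
  set T := ∑ i, B (EuclideanSpace.basisFun (Fin m) ℝ i) (EuclideanSpace.basisFun (Fin m) ℝ i)
  have hq : ContDiff ℝ 2 fun y : Euc m => B y y := by fun_prop
  have hd : fderiv ℝ (fun y : Euc m => B y y) = fun y => (B + B.flip) y := by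
    ext y v
    have := (B.hasFDerivAt (x := y)).clm_apply (hasFDerivAt_id y)
    refine (congrArg (fun A : Euc m →L[ℝ] ℝ => A v) this.fderiv).trans ?_
    simp
  have h := sphFlux_eq_integral_laplacian hm hq 0 one_pos
  have h1 : Laplacian.laplacian (fun y : Euc m => B y y) = fun _ => 2 * T := by
    ext x
    rw [laplacian_eq_sum, hd, ContinuousLinearMap.fderiv, Finset.mul_sum]
    refine Finset.sum_congr rfl fun i _ => ?_
    simp; ring
  have h2 : sphFlux (fun y : Euc m => B y y) 0 1
      = 2 * ∫ θ : sphere (0 : Euc m) 1, B θ θ ∂surfaceMeasure m := by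
    rw [sphFlux, hd, ← integral_const_mul]
    congr 1; ext θ; simp; ring
  have h3 : ∀ s, sphInt (fun _ : Euc m => 2 * T) 0 s = unitArea m * (2 * T) := fun s => by
    simp [sphInt, unitArea]
  simp only [h1, h2, h3] at h
  rw [intervalIntegral.integral_mul_const, integral_pow] at h
  have hm1 : m - 1 + 1 = m := by omega
  have hm0 : (m : ℝ) ≠ 0 := by positivity
  have hc : ((m - 1 : ℕ) : ℝ) + 1 = m := by exact_mod_cast hm1
  rw [hm1, hc] at h
  simp only [one_pow, ne_eq, show m ≠ 0 by omega, not_false_eq_true, zero_pow, sub_zero,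
    one_mul] at h
  field_simp at h
  linarith

lemma exists_contDiffOn_ball {f : Euc m → ℝ} {x : Euc m} (hf : ContDiffAt ℝ 1 f x) :
    ∃ R > 0, ContDiffOn ℝ 1 f (ball x R) := by
  obtain ⟨U, hU, hfU⟩ := hf.contDiffOn (m := 1) le_rfl (by simp)
  obtain ⟨R, hR, hb⟩ := Metric.mem_nhds_iff.1 (by simpa using hU)
  exact ⟨R, hR, hfU.mono hb⟩

/-- Expand the gradient to first order at x: the constant term integrates to zero over the sphere,
the linear term gives r times a quadratic moment, hence the trace of the Hessian, and the remainder
is o(r). -/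
lemma tendsto_flux_of_contDiffAt (hm : 2 ≤ m) {f : Euc m → ℝ} {x : Euc m}
    (hf : ContDiffAt ℝ 2 f x) :
    Tendsto (fun r => m * meanFlux f x r / r) (𝓝[>] 0) (𝓝 (Laplacian.laplacian f x)) := by
  have hS := unitArea_pos hm
  have hm0 : (0 : ℝ) < m := by positivity
  set B := fderiv ℝ (fderiv ℝ f) x with hB
  have hB' : HasFDerivAt (fderiv ℝ f) B x :=
    ((hf.fderiv_right (m := 1) le_rfl).differentiableAt one_ne_zero).hasFDerivAt
  obtain ⟨R, hR, hfR⟩ := exists_contDiffOn_ball (hf.of_le one_le_two)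
  rw [Metric.tendsto_nhdsWithin_nhds]
  intro ε hε
  have hε' : 0 < ε / (2 * m) := by positivity
  obtain ⟨δ, hδ, hd⟩ := Metric.eventually_nhds_iff.1
    ((hasFDerivAt_iff_isLittleO.1 hB').def hε')
  refine ⟨min δ R, lt_min hδ hR, fun {r} hr hrd => ?_⟩
  have hr0 : (0 : ℝ) < r := hr
  simp only [Real.dist_eq, sub_zero, abs_of_pos hr0] at hrd
  have hrδ := hrd.trans_le (min_le_left _ _)
  have hrR : |r| < R := by rw [abs_of_pos hr0]; exact hrd.trans_le (min_le_right _ _)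
  have hcont := continuous_flux_integrand hfR hrR
  set Q := ∫ θ : sphere (0 : Euc m) 1, B θ θ ∂surfaceMeasure m with hQ
  have hexp : sphFlux f x r - r * Q = ∫ θ : sphere (0 : Euc m) 1,
      (fderiv ℝ f (x + r • (θ : Euc m)) - fderiv ℝ f x - B (r • (θ : Euc m))) θ
        ∂surfaceMeasure m := by
    simp only [sub_apply, map_smul, smul_apply]
    rw [integral_sub, integral_sub, integral_sphere_clm hm, integral_smul, sub_zero, smul_eq_mul,
      sphFlux]
    · exact integrable_sphere hcont
    · exact integrable_sphere (by fun_prop)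
    · exact integrable_sphere (hcont.sub (by fun_prop))
    · exact integrable_sphere (by fun_prop)
  have hbound : ‖sphFlux f x r - r * Q‖ ≤ ε / (2 * m) * r * unitArea m := by
    rw [hexp]
    refine norm_integral_le_of_norm_le_const (Eventually.of_forall fun θ => ?_)
    refine (ContinuousLinearMap.le_opNorm _ _).trans ?_
    have := hd (y := x + r • (θ : Euc m)) (by simpa [norm_smul, abs_of_pos hr0] using hrδ)
    simpa [norm_smul, abs_of_pos hr0] using this
  have hΔ : unitArea m * Laplacian.laplacian f x = m * Q := by
    rw [laplacian_eq_sum, hQ, integral_sphere_quadratic hm]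
  have key : m * meanFlux f x r / r - Laplacian.laplacian f x
      = m * (sphFlux f x r - r * Q) / (r * unitArea m) := by
    rw [meanFlux_eq hm f x hr0]
    field_simp
    linear_combination -hΔ * r
  rw [Real.norm_eq_abs] at hbound
  rw [Real.dist_eq, key, abs_div, abs_mul, abs_of_pos hm0, abs_of_pos (mul_pos hr0 hS)]
  calc m * |sphFlux f x r - r * Q| / (r * unitArea m)
      ≤ m * (ε / (2 * m) * r * unitArea m) / (r * unitArea m) := by gcongr
    _ = ε / 2 := by field_simp
    _ < ε := half_lt_self hε

/-! ### Flux Laplacians and the maximum principle -/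

/-- The pointwise Laplacian of a `C¹` function computed from its mean fluxes through small
spheres. -/
def HasFluxLaplacian (f : Euc m → ℝ) (x : Euc m) (L : ℝ) : Prop :=
  Tendsto (fun r => m * meanFlux f x r / r) (𝓝[>] 0) (𝓝 L)

lemma HasFluxLaplacian.add (hm : 2 ≤ m) {f g : Euc m → ℝ} {x : Euc m} {a b : ℝ}
    (hf : HasFluxLaplacian f x a) (hg : HasFluxLaplacian g x b)
    (hf1 : ContDiffAt ℝ 1 f x) (hg1 : ContDiffAt ℝ 1 g x) :
    HasFluxLaplacian (fun y => f y + g y) x (a + b) := by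
  obtain ⟨R, hR, hfR⟩ := exists_contDiffOn_ball hf1
  obtain ⟨R', hR', hgR⟩ := exists_contDiffOn_ball hg1
  refine (Tendsto.add hf hg).congr' ?_
  filter_upwards [Ioo_mem_nhdsGT (lt_min hR hR')] with r hr
  have hrR : |r| < R := by rw [abs_of_pos hr.1]; exact hr.2.trans_le (min_le_left _ _)
  have hrR' : |r| < R' := by rw [abs_of_pos hr.1]; exact hr.2.trans_le (min_le_right _ _)
  have : sphFlux (fun y => f y + g y) x r = sphFlux f x r + sphFlux g x r := by
    rw [sphFlux, sphFlux, sphFlux, ← integral_add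
      (integrable_sphere (continuous_flux_integrand hfR hrR))
      (integrable_sphere (continuous_flux_integrand hgR hrR'))]
    congr 1; ext θ
    have h1 := (hfR.contDiffAt (isOpen_ball.mem_nhds
      (add_smul_mem_ball x hrR θ))).differentiableAt one_ne_zero
    have h2 := (hgR.contDiffAt (isOpen_ball.mem_nhds
      (add_smul_mem_ball x hrR' θ))).differentiableAt one_ne_zero
    rw [fderiv_fun_add h1 h2]; rfl
  rw [meanFlux_eq hm _ _ hr.1, meanFlux_eq hm _ _ hr.1, meanFlux_eq hm _ _ hr.1, this]
  ring

lemma HasFluxLaplacian.neg (hm : 2 ≤ m) {f : Euc m → ℝ} {x : Euc m} {a : ℝ}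
    (hf : HasFluxLaplacian f x a) : HasFluxLaplacian (fun y => -f y) x (-a) := by
  refine (Tendsto.neg hf).congr' ?_
  filter_upwards [self_mem_nhdsWithin] with r hr
  rw [meanFlux_eq hm _ _ hr, meanFlux_eq hm _ _ hr, sphFlux, sphFlux]
  simp only [fderiv_fun_neg, neg_apply, integral_neg]
  ring

/-- A maximum principle: a function with positive flux through all small spheres attains its
maximum over a closed ball on the boundary. -/
lemma le_of_fluxLaplacian_pos (hm : 2 ≤ m) {w : Euc m → ℝ} {c : Euc m} {R b : ℝ} (hR : 0 < R)
    (hc : ContinuousOn w (closedBall c R)) (hw : ContDiffOn ℝ 1 w (ball c R))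
    (hpos : ∀ x ∈ ball c R, ∃ L > 0, HasFluxLaplacian w x L)
    (hb : ∀ x ∈ sphere c R, w x ≤ b) : ∀ x ∈ closedBall c R, w x ≤ b := by
  obtain ⟨z, hz, hmax⟩ := (isCompact_closedBall c R).exists_isMaxOn
    (nonempty_closedBall.2 hR.le) hc
  suffices z ∈ sphere c R from fun x hx => (hmax hx).trans (hb z this)
  by_contra hzs
  have hzb : z ∈ ball c R := lt_of_le_of_ne hz hzs
  obtain ⟨ρ, hρ, hsub⟩ := Metric.isOpen_iff.1 isOpen_ball z hzb
  obtain ⟨L, hL, hlim⟩ := hpos z hzb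
  have hev : ∀ᶠ r in 𝓝[>] (0 : ℝ), 0 < m * meanFlux w z r / r := hlim.eventually (lt_mem_nhds hL)
  obtain ⟨δ, hδ, hd⟩ := mem_nhdsGT_iff_exists_Ioo_subset.1 hev
  have hS := unitArea_pos hm
  set t := min δ ρ / 2 with ht
  have hmin : 0 < min δ ρ := lt_min hδ hρ
  have ht0 : 0 < t := half_pos hmin
  have htδ : t < δ := (half_lt_self hmin).trans_le (min_le_left _ _)
  have htρ : t < ρ := (half_lt_self hmin).trans_le (min_le_right _ _)
  have hder : ∀ r ∈ Icc 0 t, HasDerivAt (sphInt w z) (sphFlux w z r) r := fun r hr =>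
    hasDerivAt_sphInt (hw.mono hsub) (by rw [abs_of_nonneg hr.1]; exact hr.2.trans_lt htρ)
  -- The radial derivative of the spherical integral is the flux, here positive. So the mean around
  -- an interior maximum `z` would strictly exceed w(z), which is absurd.
  have hmono : StrictMonoOn (sphInt w z) (Icc 0 t) := by
    refine strictMonoOn_of_deriv_pos (convex_Icc _ _)
      (fun r hr => (hder r hr).continuousAt.continuousWithinAt) fun r hr => ?_
    rw [interior_Icc] at hr
    rw [(hder r (Ioo_subset_Icc_self hr)).deriv]
    have h1 : 0 < m * meanFlux w z r / r := hd ⟨hr.1, hr.2.trans htδ⟩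
    rw [meanFlux_eq hm _ _ hr.1] at h1
    have h2 : (m : ℝ) * ((unitArea m)⁻¹ * sphFlux w z r) / r
        = (m * (unitArea m)⁻¹ / r) * sphFlux w z r := by ring
    rw [h2] at h1
    have hr0 : 0 < r := hr.1
    exact (pos_iff_pos_of_mul_pos h1).1 (by positivity)
  have hlt := hmono (left_mem_Icc.2 ht0.le) (right_mem_Icc.2 ht0.le) ht0
  have hle : sphInt w z t ≤ sphInt w z 0 := by
    have htabs : |t| ≤ t := (abs_of_pos ht0).le
    have hsub' : closedBall z t ⊆ closedBall c R :=
      (closedBall_subset_ball htρ).trans (hsub.trans ball_subset_closedBall)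
    refine integral_mono (integrable_sphere (continuous_sphere_comp (hc.mono hsub') htabs))
      (integrable_sphere (by simp only [zero_smul]; fun_prop)) fun θ => ?_
    simpa using hmax (hsub' (add_smul_mem_closedBall z htabs θ))
  exact absurd hlt (not_lt.2 hle)

lemma laplacian_norm_sub_sq (η : ℝ) (c x : Euc m) :
    Laplacian.laplacian (fun y : Euc m => η * ‖y - c‖ ^ 2) x = 2 * m * η := by
  have h1 : fderiv ℝ (fun y : Euc m => η * ‖y - c‖ ^ 2) = fun y => (2 * η) • innerSL ℝ (y - c) := by
    ext1 y
    have := ((hasStrictFDerivAt_norm_sq (y - c)).hasFDerivAt.comp y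
      ((hasFDerivAt_id y).sub_const c)).const_mul η
    refine this.fderiv.trans ?_
    ext v; simp; ring
  have h2 : fderiv ℝ (fun y : Euc m => (2 * η) • innerSL ℝ (y - c)) x = (2 * η) • innerSL ℝ := by
    have := (((innerSL ℝ (E := Euc m)).hasFDerivAt (x := x - c)).comp x
      ((hasFDerivAt_id x).sub_const c)).const_smul (2 * η)
    exact this.fderiv
  have h3 : ∀ i, (2 * η) * inner ℝ (EuclideanSpace.basisFun (Fin m) ℝ i)
      (EuclideanSpace.basisFun (Fin m) ℝ i) = 2 * η := fun i => by simp
  rw [laplacian_eq_sum, h1, h2]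
  refine (Finset.sum_congr rfl fun i _ => h3 i).trans ?_
  simp
  ring

/-- Adding η|y - c|² raises the flux Laplacian by 2mη > η, which makes it positive, at the cost of
ηR² on the sphere. -/
lemma le_of_fluxLaplacian_ge (hm : 2 ≤ m) {w ℓ : Euc m → ℝ} {c : Euc m} {R b η : ℝ} (hR : 0 < R)
    (hη : 0 < η) (hc : ContinuousOn w (closedBall c R)) (hw : ContDiffOn ℝ 1 w (ball c R))
    (hℓ : ∀ x ∈ ball c R, HasFluxLaplacian w x (ℓ x)) (hη' : ∀ x ∈ ball c R, -η ≤ ℓ x)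
    (hb : ∀ x ∈ sphere c R, w x ≤ b) : ∀ x ∈ closedBall c R, w x ≤ b + η * R ^ 2 := by
  intro x hx
  have hq : ContDiff ℝ 2 fun y : Euc m => η * ‖y - c‖ ^ 2 :=
    contDiff_const.mul ((contDiff_id.sub contDiff_const).norm_sq ℝ)
  have hm2 : (2 : ℝ) ≤ m := by exact_mod_cast hm
  have := le_of_fluxLaplacian_pos hm (w := fun y => w y + η * ‖y - c‖ ^ 2)
    (b := b + η * R ^ 2) hR (hc.add hq.continuous.continuousOn)
    (hw.add (hq.of_le one_le_two).contDiffOn) (fun y hy => ⟨ℓ y + 2 * m * η, ?_, ?_⟩)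
    (fun y hy => ?_) x hx
  · have : 0 ≤ η * ‖x - c‖ ^ 2 := by positivity
    linarith
  · have := hη' y hy
    nlinarith
  · refine (hℓ y hy).add hm ?_ (hw.contDiffAt (isOpen_ball.mem_nhds hy))
      (hq.of_le one_le_two).contDiffAt
    rw [← laplacian_norm_sub_sq η c y]
    exact tendsto_flux_of_contDiffAt hm hq.contDiffAt
  · have := hb y hy
    rw [mem_sphere_iff_norm] at hy
    rw [hy]; linarith

lemma abs_le_of_fluxLaplacian (hm : 2 ≤ m) {w ℓ : Euc m → ℝ} {c : Euc m} {R b η : ℝ} (hR : 0 < R)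
    (hη : 0 < η) (hc : ContinuousOn w (closedBall c R)) (hw : ContDiffOn ℝ 1 w (ball c R))
    (hℓ : ∀ x ∈ ball c R, HasFluxLaplacian w x (ℓ x)) (hη' : ∀ x ∈ ball c R, |ℓ x| ≤ η)
    (hb : ∀ x ∈ sphere c R, |w x| ≤ b) : ∀ x ∈ closedBall c R, |w x| ≤ b + η * R ^ 2 := by
  intro x hx
  rw [abs_le']
  exact ⟨le_of_fluxLaplacian_ge hm hR hη hc hw hℓ (fun y hy => (abs_le.1 (hη' y hy)).1)
      (fun y hy => (abs_le'.1 (hb y hy)).1) x hx,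
    le_of_fluxLaplacian_ge hm (w := fun y => -w y) hR hη hc.neg hw.neg
      (fun y hy => (hℓ y hy).neg hm) (fun y hy => neg_le_neg (abs_le.1 (hη' y hy)).2)
      (fun y hy => (abs_le'.1 (hb y hy)).2) x hx⟩

/-! ### The Dirichlet problem within polynomials -/

/-- The polynomial function on Euclidean space given by a multivariate polynomial. -/
def polyFun (p : MvPolynomial (Fin m) ℝ) (y : Euc m) : ℝ := MvPolynomial.eval (fun i => y i) p

lemma polyFun_add (p q : MvPolynomial (Fin m) ℝ) (y : Euc m) :
    polyFun (p + q) y = polyFun p y + polyFun q y := map_add _ _ _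

lemma polyFun_mul (p q : MvPolynomial (Fin m) ℝ) (y : Euc m) :
    polyFun (p * q) y = polyFun p y * polyFun q y := map_mul _ _ _

lemma hasFDerivAt_polyFun (p : MvPolynomial (Fin m) ℝ) (y : Euc m) :
    HasFDerivAt (polyFun p) (∑ i, polyFun (MvPolynomial.pderiv i p) y •
      (EuclideanSpace.proj i : Euc m →L[ℝ] ℝ)) y := by
  induction p using MvPolynomial.induction_on with
  | C a =>
    have : polyFun (MvPolynomial.C a) = fun _ : Euc m => a := by ext; simp [polyFun]
    rw [this]
    simpa [polyFun] using hasFDerivAt_const a y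
  | add p q hp hq =>
    have h : polyFun (p + q) = fun y => polyFun p y + polyFun q y := funext (polyFun_add p q)
    rw [h]
    refine (hp.fun_add hq).congr_fderiv ?_
    simp [polyFun_add, add_smul, Finset.sum_add_distrib]
  | mul_X p j hp =>
    have h : polyFun (p * MvPolynomial.X j) = fun y => polyFun p y * y j := by
      ext y; simp [polyFun]
    rw [h]
    refine (hp.fun_mul
      ((EuclideanSpace.proj j : Euc m →L[ℝ] ℝ).hasFDerivAt (x := y))).congr_fderiv ?_
    have h2 : ∀ i, polyFun (MvPolynomial.pderiv i (p * MvPolynomial.X j)) y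
        = polyFun p y * (if j = i then 1 else 0) + y j * polyFun (MvPolynomial.pderiv i p) y :=
      fun i => by
        by_cases hij : j = i <;> simp [polyFun, MvPolynomial.pderiv_X, hij]
    simp only [h2, add_smul, Finset.sum_add_distrib, mul_smul, ite_smul, one_smul, zero_smul,
      smul_ite, smul_zero, Finset.sum_ite_eq, Finset.mem_univ, if_true, Finset.smul_sum]
    rfl

lemma contDiff_polyFun (p : MvPolynomial (Fin m) ℝ) {n : WithTop ℕ∞} :
    ContDiff ℝ n (polyFun p) := by
  induction p using MvPolynomial.induction_on with
  | C a =>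
    have : polyFun (MvPolynomial.C a) = fun _ : Euc m => a := by ext; simp [polyFun]
    rw [this]
    exact contDiff_const
  | add p q hp hq =>
    have h : polyFun (p + q) = fun y => polyFun p y + polyFun q y := funext (polyFun_add p q)
    rw [h]
    exact hp.add hq
  | mul_X p j hp =>
    have h : polyFun (p * MvPolynomial.X j) = fun y => polyFun p y * y j := by
      ext y; simp [polyFun]
    rw [h]
    exact hp.mul (EuclideanSpace.proj j : Euc m →L[ℝ] ℝ).contDiff

/-- The Laplacian of a polynomial. -/
def polyLaplacian : MvPolynomial (Fin m) ℝ →ₗ[ℝ] MvPolynomial (Fin m) ℝ :=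
  ∑ i, (MvPolynomial.pderiv i).toLinearMap ∘ₗ (MvPolynomial.pderiv i).toLinearMap

lemma polyLaplacian_apply (p : MvPolynomial (Fin m) ℝ) :
    polyLaplacian p = ∑ i, MvPolynomial.pderiv i (MvPolynomial.pderiv i p) := by
  simp [polyLaplacian]

lemma laplacian_polyFun (p : MvPolynomial (Fin m) ℝ) (x : Euc m) :
    Laplacian.laplacian (polyFun p) x = polyFun (polyLaplacian p) x := by
  have h1 : ∀ (p : MvPolynomial (Fin m) ℝ) (y : Euc m) (j : Fin m),
      fderiv ℝ (polyFun p) y (EuclideanSpace.basisFun (Fin m) ℝ j)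
        = polyFun (MvPolynomial.pderiv j p) y := fun p y j => by
    rw [(hasFDerivAt_polyFun p y).fderiv]
    simp [PiLp.single_apply]
  have hd : Differentiable ℝ (fderiv ℝ (polyFun p)) :=
    ((contDiff_polyFun p (n := 2)).fderiv_right (m := 1) le_rfl).differentiable one_ne_zero
  rw [laplacian_eq_sum, polyLaplacian_apply]
  simp only [polyFun, map_sum]
  refine Finset.sum_congr rfl fun i _ => ?_
  have h2 := fderiv_clm_apply (hd x)
    (differentiableAt_const (𝕜 := ℝ) (c := EuclideanSpace.basisFun (Fin m) ℝ i))
  have h3 := h1 (MvPolynomial.pderiv i p) x i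
  rw [← show (fun y => fderiv ℝ (polyFun p) y (EuclideanSpace.basisFun (Fin m) ℝ i))
    = polyFun (MvPolynomial.pderiv i p) from funext fun y => h1 p y i, h2] at h3
  simpa [polyFun] using h3

lemma totalDegree_pderiv_le (p : MvPolynomial (Fin m) ℝ) (i : Fin m) :
    (MvPolynomial.pderiv i p).totalDegree ≤ p.totalDegree - 1 := by
  conv_lhs => rw [p.as_sum, map_sum]
  refine MvPolynomial.totalDegree_finsetSum_le fun v hv => ?_
  rw [MvPolynomial.pderiv_monomial]
  rcases Nat.eq_zero_or_pos (v i) with h | h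
  · simp [h]
  · refine (MvPolynomial.totalDegree_monomial_le _ _).trans ?_
    have hle := MvPolynomial.le_totalDegree hv
    have h1 : Finsupp.single i 1 ≤ v := by simpa using Nat.succ_le_of_lt h
    have h2 : (v - Finsupp.single i 1).degree + 1 = v.degree := by
      conv_rhs => rw [← tsub_add_cancel_of_le h1, map_add]
      simp
    have h3 : v.degree ≤ p.totalDegree := hle
    change (v - Finsupp.single i 1).degree ≤ _
    omega

lemma totalDegree_polyLaplacian_le (p : MvPolynomial (Fin m) ℝ) :
    (polyLaplacian p).totalDegree ≤ p.totalDegree - 2 := by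
  rw [polyLaplacian_apply]
  refine MvPolynomial.totalDegree_finsetSum_le fun i _ => ?_
  have h1 := totalDegree_pderiv_le p i
  have h2 := totalDegree_pderiv_le (MvPolynomial.pderiv i p) i
  omega

/-- The polynomial `R² - |y - c|²`. -/
def ballPoly (c : Euc m) (R : ℝ) : MvPolynomial (Fin m) ℝ :=
  MvPolynomial.C (R ^ 2) - ∑ i, (MvPolynomial.X i - MvPolynomial.C (c i)) ^ 2

lemma polyFun_ballPoly (c y : Euc m) (R : ℝ) : polyFun (ballPoly c R) y = R ^ 2 - ‖y - c‖ ^ 2 := by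
  simp [polyFun, ballPoly, EuclideanSpace.norm_sq_eq]

lemma totalDegree_ballPoly_le (c : Euc m) (R : ℝ) : (ballPoly c R).totalDegree ≤ 2 := by
  refine (MvPolynomial.totalDegree_sub _ _).trans (max_le ?_ ?_)
  · rw [MvPolynomial.totalDegree_C]; exact zero_le_two
  refine MvPolynomial.totalDegree_finsetSum_le fun i _ => ?_
  refine (MvPolynomial.totalDegree_pow _ _).trans ?_
  have := (MvPolynomial.totalDegree_sub_C_le (MvPolynomial.X i : MvPolynomial (Fin m) ℝ) (c i))
  simp at this
  omega

/-- The ball contains a box, a product of infinite sets, on which a polynomial is determined by its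
values. -/
lemma polyFun_eq_zero_of_ball {s : MvPolynomial (Fin m) ℝ} {c : Euc m} {R : ℝ} (hR : 0 < R)
    (h : ∀ y ∈ ball c R, polyFun s y = 0) : s = 0 := by
  have hopen : IsOpen ((WithLp.toLp 2 : (Fin m → ℝ) → Euc m) ⁻¹' ball c R) :=
    isOpen_ball.preimage (PiLp.continuous_toLp 2 _)
  obtain ⟨δ, hδ, hsub⟩ := Metric.isOpen_iff.1 hopen (fun i => c i) (by simpa using hR)
  refine MvPolynomial.funext_set (fun i => ball (c i) δ) (fun i => ?_) fun v hv => ?_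
  · rw [Real.ball_eq_Ioo]; exact Ioo_infinite (by linarith)
  · rw [← ball_pi _ hδ] at hv
    rw [map_zero]
    exact h _ (hsub hv)

/-- The product is harmonic and vanishes on the sphere, hence vanishes in the ball by the maximum
principle. There R² - |y - c|² is positive and can be cancelled. -/
lemma polyLaplacian_ballPoly_mul_injective (hm : 2 ≤ m) {c : Euc m} {R : ℝ} (hR : 0 < R)
    {s : MvPolynomial (Fin m) ℝ} (hs : polyLaplacian (ballPoly c R * s) = 0) : s = 0 := by
  refine polyFun_eq_zero_of_ball (c := c) hR fun y hy => ?_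
  have hC : ContDiff ℝ 2 (polyFun (ballPoly c R * s)) := contDiff_polyFun _
  have hle : ∀ η > 0, |polyFun (ballPoly c R * s) y| ≤ 0 + η * R ^ 2 := fun η hη =>
    abs_le_of_fluxLaplacian hm (ℓ := fun _ => 0) hR hη hC.continuous.continuousOn
      (hC.of_le one_le_two).contDiffOn (fun x _ => by
        have h1 : Laplacian.laplacian (polyFun (ballPoly c R * s)) x = 0 := by
          rw [laplacian_polyFun, hs]; simp [polyFun]
        rw [← h1]
        exact tendsto_flux_of_contDiffAt hm hC.contDiffAt)
      (fun x _ => by simpa using hη.le) (fun x hx => by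
        rw [mem_sphere_iff_norm] at hx
        simp [polyFun_mul, polyFun_ballPoly, hx]) y (ball_subset_closedBall hy)
  have h0 : |polyFun (ballPoly c R * s) y| ≤ 0 := by
    refine le_of_forall_pos_le_add fun ε hε => ?_
    have := hle (ε / R ^ 2) (by positivity)
    rwa [div_mul_cancel₀ _ (by positivity)] at this
  have h1 := abs_nonpos_iff.1 h0
  rw [polyFun_mul, polyFun_ballPoly] at h1
  refine (mul_eq_zero.1 h1).resolve_left ?_
  rw [mem_ball_iff_norm] at hy
  nlinarith [norm_nonneg (y - c)]

/-- The Dirichlet problem `Δ q = g` with polynomial data `p` on a sphere has a polynomial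
solution. -/
lemma exists_polyLaplacian_eq (hm : 2 ≤ m) (c : Euc m) {R : ℝ} (hR : 0 < R)
    (p g : MvPolynomial (Fin m) ℝ) :
    ∃ q : MvPolynomial (Fin m) ℝ, polyLaplacian q = g ∧
      ∀ y ∈ sphere c R, polyFun q y = polyFun p y := by
  -- Seek q = p + (R² - |y - c|²) s, which has the right boundary values. The map s ↦ Δ((R² - |y -
  -- c|²) s) preserves degree ≤ n, a finite-dimensional space, so its injectivity gives
  -- surjectivity.
  set n := max p.totalDegree g.totalDegree with hn
  set V := MvPolynomial.restrictTotalDegree (Fin m) ℝ n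
  have hmaps : ∀ s ∈ V, (polyLaplacian ∘ₗ LinearMap.mulLeft ℝ (ballPoly c R)) s ∈ V := by
    intro s hs
    rw [MvPolynomial.mem_restrictTotalDegree] at hs ⊢
    have h1 := totalDegree_polyLaplacian_le (ballPoly c R * s)
    have h2 := MvPolynomial.totalDegree_mul (ballPoly c R) s
    have h3 := totalDegree_ballPoly_le c R
    simp only [LinearMap.comp_apply, LinearMap.mulLeft_apply]
    omega
  set T : V →ₗ[ℝ] V := (polyLaplacian ∘ₗ LinearMap.mulLeft ℝ (ballPoly c R)).restrict hmaps
  have hinj : Function.Injective T := by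
    rw [injective_iff_map_eq_zero]
    intro s hs
    have : polyLaplacian (ballPoly c R * (s : MvPolynomial (Fin m) ℝ)) = 0 :=
      congrArg Subtype.val hs
    exact Subtype.ext (polyLaplacian_ballPoly_mul_injective hm hR this)
  have hg : g - polyLaplacian p ∈ V := by
    refine V.sub_mem ?_ ?_
    · rw [MvPolynomial.mem_restrictTotalDegree]; exact le_max_right _ _
    · rw [MvPolynomial.mem_restrictTotalDegree]
      have := totalDegree_polyLaplacian_le p
      omega
  obtain ⟨s, hs⟩ := LinearMap.injective_iff_surjective.1 hinj ⟨_, hg⟩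
  have hs' : polyLaplacian (ballPoly c R * (s : MvPolynomial (Fin m) ℝ)) = g - polyLaplacian p :=
    congrArg Subtype.val hs
  refine ⟨p + ballPoly c R * s, by rw [map_add, hs']; ring, fun y hy => ?_⟩
  rw [mem_sphere_iff_norm] at hy
  simp [polyFun_add, polyFun_mul, polyFun_ballPoly, hy]

/-! ### Smooth approximation -/

lemma exists_polyFun_near {K : Set (Euc m)} (hK : IsCompact K) {u : Euc m → ℝ}
    (hu : ContinuousOn u K) {ε : ℝ} (hε : 0 < ε) :
    ∃ p : MvPolynomial (Fin m) ℝ, ∀ x ∈ K, |u x - polyFun p x| < ε := by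
  have : CompactSpace K := isCompact_iff_compactSpace.1 hK
  set X : Fin m → C(K, ℝ) := fun i => ⟨fun x => (x : Euc m) i, by fun_prop⟩
  have hev : ∀ (p : MvPolynomial (Fin m) ℝ) (x : K),
      MvPolynomial.aeval X p x = polyFun p x := fun p x => by
    induction p using MvPolynomial.induction_on with
    | C a => simp [polyFun]
    | add p q hp hq => rw [map_add, polyFun_add, ← hp, ← hq]; rfl
    | mul_X p j hp =>
      rw [map_mul, polyFun_mul, ← hp, MvPolynomial.aeval_X]
      simp [polyFun, X]
  have hsep : (MvPolynomial.aeval X : MvPolynomial (Fin m) ℝ →ₐ[ℝ] C(K, ℝ)).range.SeparatesPoints := by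
    intro x y hxy
    obtain ⟨i, hi⟩ : ∃ i, (x : Euc m) i ≠ (y : Euc m) i := by
      by_contra! h
      exact hxy (Subtype.ext (PiLp.ext h))
    exact ⟨X i, ⟨X i, ⟨MvPolynomial.X i, by simp⟩, rfl⟩, hi⟩
  obtain ⟨⟨g, p, hp⟩, hg⟩ := ContinuousMap.exists_mem_subalgebra_near_continuousMap_of_separatesPoints
    _ hsep ⟨K.domRestrict u, hu.domRestrict⟩ ε hε
  refine ⟨p, fun x hx => ?_⟩
  have h1 := (ContinuousMap.norm_lt_iff _ hε).1 hg ⟨x, hx⟩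
  have h2 : g ⟨x, hx⟩ = polyFun p x := by rw [← hp]; exact hev p ⟨x, hx⟩
  simp only [ContinuousMap.sub_apply, ContinuousMap.coe_mk, Set.domRestrict_apply, h2,
    Real.norm_eq_abs] at h1
  rwa [abs_sub_comm]

/-- A function whose flux Laplacian is `-k u` is a uniform limit of smooth functions whose
Laplacians converge uniformly to `-k u`. -/
lemma exists_smooth_approx (hm : 2 ≤ m) {u : Euc m → ℝ} {c : Euc m} {R k ε : ℝ} (hR : 0 < R)
    (hu : ContinuousOn u (closedBall c R)) (hu1 : ContDiffOn ℝ 1 u (ball c R))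
    (hk : ∀ x ∈ ball c R, HasFluxLaplacian u x (-k * u x)) (hε : 0 < ε) :
    ∃ q : Euc m → ℝ, ContDiff ℝ 2 q ∧ ∀ x ∈ closedBall c R,
      |u x - q x| ≤ ε ∧ |Laplacian.laplacian q x + k * u x| ≤ ε := by
  -- With |u - p| < ε/A, the maximum principle bounds u - q by (ε/A)(1 + (|k| + 1)R²), and Δq + k u
  -- is at most |k|ε/A. `A` dominates both factors; |k| + 1 replaces |k| to keep `η` positive.
  set A := 1 + |k| + (|k| + 1) * R ^ 2 with hA
  have hk0 := abs_nonneg k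
  have hA1 : 1 + |k| ≤ A := by rw [hA]; nlinarith [sq_nonneg R]
  have hA0 : 0 < A := by linarith
  have hδ : 0 < ε / A := div_pos hε hA0
  obtain ⟨p, hp⟩ := exists_polyFun_near (isCompact_closedBall c R) hu hδ
  obtain ⟨q, hq, hqp⟩ := exists_polyLaplacian_eq hm c hR p (-MvPolynomial.C k * p)
  have hqC : ContDiff ℝ 2 (polyFun q) := contDiff_polyFun q
  have hΔ : ∀ x, Laplacian.laplacian (polyFun q) x = -k * polyFun p x := fun x => by
    rw [laplacian_polyFun, hq]; simp [polyFun]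
  refine ⟨polyFun q, hqC, fun x hx => ⟨?_, ?_⟩⟩
  · have := abs_le_of_fluxLaplacian hm (w := fun x => u x + -polyFun q x)
      (ℓ := fun x => -k * u x + -(-k * polyFun p x)) (b := ε / A) (η := (|k| + 1) * (ε / A)) hR
      (by positivity) (hu.add hqC.continuous.neg.continuousOn)
      (hu1.add (hqC.of_le one_le_two).neg.contDiffOn) (fun y hy => ?_) (fun y hy => ?_)
      (fun y hy => ?_) x hx
    · rw [sub_eq_add_neg]
      refine this.trans ?_
      have h1 : ε / A + (|k| + 1) * (ε / A) * R ^ 2 = (ε / A) * (1 + (|k| + 1) * R ^ 2) := by ring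
      rw [h1]
      calc ε / A * (1 + (|k| + 1) * R ^ 2) ≤ ε / A * A := by
            gcongr; rw [hA]; linarith
        _ = ε := div_mul_cancel₀ _ hA0.ne'
    · refine (hk y hy).add hm (HasFluxLaplacian.neg hm ?_)
        (hu1.contDiffAt (isOpen_ball.mem_nhds hy)) (hqC.of_le one_le_two).neg.contDiffAt
      rw [← hΔ y]
      exact tendsto_flux_of_contDiffAt hm hqC.contDiffAt
    · have h1 := hp y (ball_subset_closedBall hy)
      have h2 : -k * u y + -(-k * polyFun p y) = -k * (u y - polyFun p y) := by ring
      rw [h2, abs_mul, abs_neg]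
      exact mul_le_mul (by linarith) h1.le (abs_nonneg _) (by linarith)
    · rw [hqp y hy, ← sub_eq_add_neg]
      exact (hp y (sphere_subset_closedBall hy)).le
  · have h2 : -k * polyFun p x + k * u x = k * (u x - polyFun p x) := by ring
    rw [hΔ, h2, abs_mul]
    calc |k| * |u x - polyFun p x| ≤ A * (ε / A) :=
          mul_le_mul (by linarith) (hp x hx).le (abs_nonneg _) hA0.le
      _ = ε := mul_div_cancel₀ _ hA0.ne'

/-! ### Proportionality of spherical means -/

lemma abs_sphInt_sub_le {f g : Euc m → ℝ} {x : Euc m} {t R ε : ℝ} (ht : |t| ≤ R)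
    (hf : ContinuousOn f (closedBall x R)) (hg : ContinuousOn g (closedBall x R))
    (h : ∀ z ∈ closedBall x R, |f z - g z| ≤ ε) :
    |sphInt f x t - sphInt g x t| ≤ ε * unitArea m := by
  rw [sphInt, sphInt, ← integral_sub (integrable_sphere (continuous_sphere_comp hf ht))
    (integrable_sphere (continuous_sphere_comp hg ht)), ← Real.norm_eq_abs]
  exact norm_integral_le_of_norm_le_const
    (Eventually.of_forall fun θ => h _ (add_smul_mem_closedBall x ht θ))

/-- A Grönwall-type estimate for the combination of two spherical means of a smooth function. -/
lemma abs_sphInt_comb_le (hm : 2 ≤ m) {q : Euc m → ℝ} (hq : ContDiff ℝ 2 q) (x y : Euc m)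
    {α β k ρ M₀ ε : ℝ} (hρ : 0 < ρ) (hkρ : |k| * ρ ^ 2 ≤ 1 / 2)
    (h0 : |α * q x - β * q y| * unitArea m ≤ M₀)
    (hε : ∀ t ∈ Icc 0 ρ, |(α * sphInt (Laplacian.laplacian q) x t
        - β * sphInt (Laplacian.laplacian q) y t)
        + k * (α * sphInt q x t - β * sphInt q y t)| ≤ ε) :
    ∀ t ∈ Icc 0 ρ, |α * sphInt q x t - β * sphInt q y t| ≤ 2 * (M₀ + ε * ρ ^ 2) := by
  have hS := unitArea_pos hm
  have hq1 : ContDiff ℝ 1 q := hq.of_le one_le_two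
  have hΔ := continuous_laplacian hq
  have hcx := continuous_sphInt hΔ x
  have hcy := continuous_sphInt hΔ y
  set H : ℝ → ℝ := fun t => α * sphInt q x t - β * sphInt q y t with hH
  set H' : ℝ → ℝ := fun t => α * sphFlux q x t - β * sphFlux q y t with hH'
  have hder : ∀ t, HasDerivAt H (H' t) t := fun t => by
    have h1 : ∀ z, HasDerivAt (sphInt q z) (sphFlux q z t) t := fun z =>
      hasDerivAt_sphInt (R := |t| + 1) hq1.contDiffOn (by linarith)
    exact ((h1 x).const_mul α).sub ((h1 y).const_mul β)
  have hHc : Continuous H := continuous_iff_continuousAt.2 fun t => (hder t).continuousAt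
  obtain ⟨t₀, ht₀, hmax⟩ := (isCompact_Icc (a := (0 : ℝ)) (b := ρ)).exists_isMaxOn
    (nonempty_Icc.2 hρ.le) hHc.abs.continuousOn
  -- The divergence theorem reads (s^(m-1) H')' = s^(m-1) b with |b| ≤ |k|M + ε, whence |H'| ≤ Nρ.
  -- Integrating once more, |k|ρ² ≤ 1/2 allows half of `M` to be absorbed on the left.
  set M := |H t₀| with hM
  have hMle : ∀ t ∈ Icc 0 ρ, |H t| ≤ M := fun t ht => hmax ht
  set N := |k| * M + ε with hN
  have hε0 : 0 ≤ ε := (abs_nonneg _).trans (hε 0 (left_mem_Icc.2 hρ.le))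
  have hN0 : 0 ≤ N := by positivity
  set b : ℝ → ℝ := fun t => α * sphInt (Laplacian.laplacian q) x t
        - β * sphInt (Laplacian.laplacian q) y t with hb
  have hbN : ∀ t ∈ Icc 0 ρ, |b t| ≤ N := fun t ht => by
    have h1 : b t = (b t + k * H t) - k * H t := by ring
    rw [h1]
    refine (abs_sub _ _).trans ?_
    rw [abs_mul]
    have h2 := hε t ht
    have h3 := mul_le_mul_of_nonneg_left (hMle t ht) (abs_nonneg k)
    linarith
  have hH'N : ∀ s ∈ Icc 0 ρ, |H' s| ≤ N * ρ := by
    intro s hs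
    rcases hs.1.eq_or_lt with rfl | hs0
    · have h1 : ∀ z, sphFlux q z 0 = 0 := fun z => by
        simpa [sphFlux] using integral_sphere_clm hm (fderiv ℝ q z)
      simp only [hH', h1]
      simpa using mul_nonneg hN0 hρ.le
    · have h1 : s ^ (m - 1) * H' s = ∫ t in (0 : ℝ)..s, t ^ (m - 1) * b t := by
        have hx := sphFlux_eq_integral_laplacian hm hq x hs0
        have hy := sphFlux_eq_integral_laplacian hm hq y hs0
        have h2 : s ^ (m - 1) * H' s = α * (s ^ (m - 1) * sphFlux q x s)
          - β * (s ^ (m - 1) * sphFlux q y s) := by simp only [hH']; ring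
        rw [h2, ← hx, ← hy, ← intervalIntegral.integral_const_mul,
          ← intervalIntegral.integral_const_mul, ← intervalIntegral.integral_sub
          (Continuous.intervalIntegrable (by fun_prop) _ _)
          (Continuous.intervalIntegrable (by fun_prop) _ _)]
        congr 1; ext t; simp only [hb]; ring
      have h3 : ‖∫ t in (0 : ℝ)..s, t ^ (m - 1) * b t‖ ≤ s ^ (m - 1) * N * |s - 0| := by
        refine intervalIntegral.norm_integral_le_of_norm_le_const fun t ht => ?_
        rw [uIoc_of_le hs0.le] at ht
        rw [norm_mul, Real.norm_eq_abs, Real.norm_eq_abs, abs_of_nonneg (pow_nonneg ht.1.le _)]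
        exact mul_le_mul (pow_le_pow_left₀ ht.1.le ht.2 _)
          (hbN t ⟨ht.1.le, ht.2.trans hs.2⟩) (abs_nonneg _) (pow_nonneg hs0.le _)
      have hsp : 0 < s ^ (m - 1) := pow_pos hs0 _
      rw [← h1, Real.norm_eq_abs, abs_mul, abs_of_pos hsp, sub_zero, abs_of_pos hs0, mul_assoc] at h3
      exact (le_of_mul_le_mul_left h3 hsp).trans (mul_le_mul_of_nonneg_left hs.2 hN0)
  have hdiff := norm_image_sub_le_of_norm_deriv_le_segment' (f := H) (f' := H') (a := 0) (b := ρ)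
    (C := N * ρ) (fun t _ => (hder t).hasDerivWithinAt)
    (fun t ht => hH'N t (Ico_subset_Icc_self ht)) t₀ ht₀
  have hH0 : |H 0| ≤ M₀ := by
    have : H 0 = (α * q x - β * q y) * unitArea m := by
      simp only [hH, sphInt_zero]; ring
    rw [this, abs_mul, abs_of_pos hS]; exact h0
  have hfin : M ≤ 2 * (M₀ + ε * ρ ^ 2) := by
    rw [Real.norm_eq_abs, sub_zero] at hdiff
    have h1 : M ≤ |H t₀ - H 0| + |H 0| := by
      have := abs_add_le (H t₀ - H 0) (H 0)
      rwa [sub_add_cancel] at this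
    have h2 : N * ρ * t₀ ≤ N * ρ * ρ := mul_le_mul_of_nonneg_left ht₀.2 (by positivity)
    have h3 : N * ρ * ρ = (|k| * ρ ^ 2) * M + ε * ρ ^ 2 := by rw [hN]; ring
    have h4 := mul_le_mul_of_nonneg_right hkρ (abs_nonneg (H t₀))
    linarith
  exact fun t ht => (hMle t ht).trans hfin

/-- The spherical means of a function with flux Laplacian `-k u` around any two points are
proportional, with the values at the two points as factors. -/
lemma sphInt_mul_eq (hm : 2 ≤ m) {u : Euc m → ℝ} {c : Euc m} {R k ρ : ℝ} (hR : 0 < R)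
    (hu : ContinuousOn u (closedBall c R)) (hu1 : ContDiffOn ℝ 1 u (ball c R))
    (hk : ∀ x ∈ ball c R, HasFluxLaplacian u x (-k * u x)) (hρ : 0 < ρ) (hρR : ρ ≤ R / 2)
    (hkρ : |k| * ρ ^ 2 ≤ 1 / 2) {x y : Euc m} (hx : x ∈ ball c (R / 2)) (hy : y ∈ ball c (R / 2))
    {t : ℝ} (ht : t ∈ Icc 0 ρ) : u y * sphInt u x t = u x * sphInt u y t := by
  set S := unitArea m with hSdef
  have hS : 0 < S := unitArea_pos hm
  set C := |u y| + |u x| with hC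
  have hC0 : 0 ≤ C := by positivity
  have hk0 := abs_nonneg k
  have hsub : ∀ z ∈ ball c (R / 2), closedBall z ρ ⊆ closedBall c R := fun z hz =>
    closedBall_subset_closedBall' (by rw [mem_ball] at hz; linarith)
  have htρ : ∀ s ∈ Icc (0 : ℝ) ρ, |s| ≤ ρ := fun s hs => by rw [abs_of_nonneg hs.1]; exact hs.2
  have comb : ∀ a b δ : ℝ, |a| ≤ δ → |b| ≤ δ → |u y * a - u x * b| ≤ C * δ := by
    intro a b δ ha hb
    refine (abs_sub _ _).trans ?_
    rw [abs_mul, abs_mul, hC, add_mul]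
    gcongr
  have hall : ∀ ε > 0, |u y * sphInt u x t - u x * sphInt u y t|
      ≤ ε * (C * S + 2 * (C * S + C * ((1 + |k|) * S) * ρ ^ 2)) := by
    intro ε hε
    obtain ⟨q, hq, hqu⟩ := exists_smooth_approx hm hR hu hu1 hk hε
    have hqc := hq.continuous
    have hΔ := continuous_laplacian hq
    have hΔq : ∀ z ∈ closedBall c R, |Laplacian.laplacian q z - (-k * q z)| ≤ (1 + |k|) * ε := by
      intro z hz
      obtain ⟨h1, h2⟩ := hqu z hz
      have h3 : Laplacian.laplacian q z - (-k * q z)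
          = (Laplacian.laplacian q z + k * u z) - k * (u z - q z) := by ring
      rw [h3]
      refine (abs_sub _ _).trans ?_
      rw [abs_mul]
      have := mul_le_mul_of_nonneg_left h1 hk0
      linarith
    -- The combination for u itself starts at u(y)u(x) - u(x)u(y) = 0, so the one for q starts
    -- within Cε, and every error is linear in ε.
    have hmain := abs_sphInt_comb_le hm hq x y (α := u y) (β := u x) (k := k) (ρ := ρ)
      (M₀ := C * ε * S) (ε := C * ((1 + |k|) * ε * S)) hρ hkρ ?_ ?_ t ht
    · have hd : ∀ z ∈ ball c (R / 2), |sphInt u z t - sphInt q z t| ≤ ε * S := fun z hz =>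
        abs_sphInt_sub_le (htρ t ht) (hu.mono (hsub z hz)) hqc.continuousOn
          fun w hw => (hqu w (hsub z hz hw)).1
      have h1 := comb _ _ _ (hd x hx) (hd y hy)
      have h2 : u y * sphInt u x t - u x * sphInt u y t
          = (u y * (sphInt u x t - sphInt q x t) - u x * (sphInt u y t - sphInt q y t))
            + (u y * sphInt q x t - u x * sphInt q y t) := by ring
      rw [h2]
      refine (abs_add_le _ _).trans ?_
      refine (add_le_add h1 hmain).trans (le_of_eq ?_)
      ring
    · have hcx : x ∈ closedBall c R := hsub x hx (mem_closedBall_self hρ.le)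
      have hcy : y ∈ closedBall c R := hsub y hy (mem_closedBall_self hρ.le)
      have h1 := comb (u x - q x) (u y - q y) ε (hqu x hcx).1 (hqu y hcy).1
      have h2 : u y * (u x - q x) - u x * (u y - q y) = -(u y * q x - u x * q y) := by ring
      rw [h2, abs_neg] at h1
      exact mul_le_mul_of_nonneg_right h1 hS.le
    · intro s hs
      have hd : ∀ z ∈ ball c (R / 2), |sphInt (Laplacian.laplacian q) z s + k * sphInt q z s|
          ≤ (1 + |k|) * ε * S := fun z hz => by
        have h1 := abs_sphInt_sub_le (g := fun w => -k * q w) (htρ s hs) hΔ.continuousOn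
          (by fun_prop) fun w hw => hΔq w (hsub z hz hw)
        have h2 : sphInt (fun w => -k * q w) z s = -k * sphInt q z s := by
          rw [sphInt, sphInt, integral_const_mul]
        rw [h2] at h1
        simpa using h1
      have h1 := comb _ _ _ (hd x hx) (hd y hy)
      refine le_trans (le_of_eq ?_) h1
      congr 1; ring
  set K := C * S + 2 * (C * S + C * ((1 + |k|) * S) * ρ ^ 2) with hK
  have hK0 : 0 ≤ K := by positivity
  have hzero : |u y * sphInt u x t - u x * sphInt u y t| ≤ 0 := by
    refine le_of_forall_pos_le_add fun ε hε => ?_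
    have h1 := hall (ε / (K + 1)) (by positivity)
    refine h1.trans ?_
    rw [zero_add, div_mul_eq_mul_div, div_le_iff₀ (by positivity)]
    nlinarith
  exact sub_eq_zero.1 (abs_nonpos_iff.1 hzero)

/-! ### Regularity and the theorem -/

/-- A function with flux Laplacian `-k u` whose spherical means of small radius are `C²` is
itself `C²`. -/
lemma contDiffAt_of_fluxLaplacian (hm : 2 ≤ m) {u : Euc m → ℝ} {D : Set (Euc m)} (hD : IsOpen D)
    (hu1 : ContDiffOn ℝ 1 u D) {k r₀ : ℝ} (hr₀ : 0 < r₀)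
    (hC2 : ∀ r, 0 < r → r < r₀ →
      ContDiffOn ℝ 2 (fun x => sphereMean u x r) {x | Admissible D x r})
    (hk : ∀ x ∈ D, HasFluxLaplacian u x (-k * u x)) {c : Euc m} (hc : c ∈ D) :
    ContDiffAt ℝ 2 u c := by
  obtain ⟨R, hR, hRD⟩ := Metric.nhds_basis_closedBall.mem_iff.1 (hD.mem_nhds hc)
  have hR2 : 0 < R / 2 := half_pos hR
  by_cases hz : ∀ x ∈ ball c (R / 2), u x = 0
  · refine (contDiffAt_const (c := (0 : ℝ))).congr_of_eventuallyEq ?_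
    filter_upwards [ball_mem_nhds c hR2] with x hx using hz x hx
  push Not at hz
  obtain ⟨y, hy, huy⟩ := hz
  have hS := unitArea_pos hm
  have hk0 := abs_nonneg k
  -- The three bounds keep the balls inside D, the spherical means C², and |k|ρ² ≤ 1/2.
  set ρ := min (min (R / 2) r₀) (1 / (2 * (|k| + 1))) with hρdef
  have hρ : 0 < ρ := lt_min (lt_min hR2 hr₀) (by positivity)
  have hρR : ρ ≤ R / 2 := (min_le_left _ _).trans (min_le_left _ _)
  have hρr : ρ ≤ r₀ := (min_le_left _ _).trans (min_le_right _ _)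
  have hkρ : |k| * ρ ^ 2 ≤ 1 / 2 := by
    have h1 : ρ * (2 * (|k| + 1)) ≤ 1 := by
      rw [← le_div_iff₀ (by positivity)]; exact min_le_right _ _
    have h2 : ρ ≤ 1 := by nlinarith
    nlinarith [mul_nonneg hk0 hρ.le]
  have hsubD : ball c R ⊆ D := ball_subset_closedBall.trans hRD
  have hyD : ball y (R / 2) ⊆ D := by
    refine (ball_subset_ball' ?_).trans hsubD
    rw [mem_ball] at hy; linarith
  have hcont : ContinuousAt (sphInt u y) 0 :=
    (hasDerivAt_sphInt (hu1.mono hyD) (by simpa using hR2)).continuousAt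
  have hne0 : sphInt u y 0 ≠ 0 := by rw [sphInt_zero]; exact mul_ne_zero hS.ne' huy
  obtain ⟨t, htne, ht0, htρ⟩ : ∃ t, sphInt u y t ≠ 0 ∧ 0 < t ∧ t < ρ := by
    have h1 : ∀ᶠ t in 𝓝[>] (0 : ℝ), sphInt u y t ≠ 0 :=
      (hcont.eventually_ne hne0).filter_mono nhdsWithin_le_nhds
    obtain ⟨t, h2, h3⟩ := (h1.and (Ioo_mem_nhdsGT hρ)).exists
    exact ⟨t, h2, h3⟩
  -- Here y and t are fixed with a nonzero spherical integral, so the proportionality can be solved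
  -- for u(x).
  have hrep : ∀ x ∈ ball c (R / 2),
      u x = u y * unitArea m / sphInt u y t * sphereMean u x t := fun x hx => by
    have := sphInt_mul_eq hm hR (hu1.continuousOn.mono hRD) (hu1.mono hsubD)
      (fun z hz => hk z (hsubD hz)) hρ hρR hkρ hx hy ⟨ht0.le, htρ.le⟩
    rw [sphereMean_eq hm u x ht0]
    field_simp
    linarith
  have hadm : ball c (R / 2) ⊆ {x | Admissible D x t} := fun x hx => by
    refine ⟨ht0, closure_ball_subset_closedBall.trans ?_⟩
    refine (closedBall_subset_closedBall' ?_).trans hRD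
    rw [mem_ball] at hx; linarith
  have hCD : ContDiffOn ℝ 2 u (ball c (R / 2)) :=
    (contDiffOn_const.mul ((hC2 t ht0 (htρ.trans_le hρr)).mono hadm)).congr hrep
  exact hCD.contDiffAt (ball_mem_nhds c hR2)

end

open Filter Topology

theorem theorem6 {m : ℕ} (hm : 2 ≤ m) (lam : ℂ)
    (D : Set (EuclideanSpace ℝ (Fin m)))
    (hDopen : IsOpen D) (hDconn : IsConnected D) (hDbdd : Bornology.IsBounded D)
    (u : EuclideanSpace ℝ (Fin m) → ℝ)
    (hu1 : ContDiffOn ℝ 1 u D) (hu0 : ContinuousOn u (closure D))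
    (hC2 : ∃ r₀ : ℝ, 0 < r₀ ∧ ∀ r : ℝ, 0 < r → r < r₀ →
      ContDiffOn ℝ 2 (fun x => meanFlux u x r) {x | Admissible D x r} ∧
      ContDiffOn ℝ 2 (fun x => sphereMean u x r) {x | Admissible D x r})
    (rad : EuclideanSpace ℝ (Fin m) → ℝ)
    (hrad : ∀ x ∈ D, Admissible D x (rad x))
    (hflux : ∀ x ∈ D, ∀ r ∈ Set.Ioc (0 : ℝ) (rad x),
      (m : ℂ) * ((meanFlux u x r : ℝ) : ℂ)
        = -(lam ^ 2) * (r : ℂ) * ((ballMean u x r : ℝ) : ℂ)) :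
    Metaharmonic lam u D := by
  obtain ⟨r₀, hr₀, hC2⟩ := hC2
  have hball : ∀ x ∈ D, Tendsto (ballMean u x) (𝓝[>] 0) (𝓝 (u x)) := fun x hx => by
    obtain ⟨R, hR, hRD⟩ := Metric.nhds_basis_closedBall.mem_iff.1 (hDopen.mem_nhds hx)
    exact tendsto_ballMean hR (hu1.continuousOn.mono hRD)
  by_cases him : (lam ^ 2).im = 0
  · set k := (lam ^ 2).re with hk
    have hlam : lam ^ 2 = (k : ℂ) := Complex.ext rfl (by simpa using him)
    have hflux' : ∀ x ∈ D, HasFluxLaplacian u x (-k * u x) := fun x hx => by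
      refine ((hball x hx).const_mul (-k)).congr' ?_
      filter_upwards [Ioc_mem_nhdsGT (hrad x hx).1] with r hr
      have h1 := hflux x hx r hr
      rw [hlam] at h1
      have h2 : (m : ℝ) * meanFlux u x r = -k * r * ballMean u x r := by exact_mod_cast h1
      have hr0 : r ≠ 0 := hr.1.ne'
      rw [h2]; field_simp
    have hCD : ∀ x ∈ D, ContDiffAt ℝ 2 u x := fun x hx =>
      contDiffAt_of_fluxLaplacian hm hDopen hu1 hr₀ (fun r h1 h2 => (hC2 r h1 h2).2) hflux' hx
    refine ⟨fun x hx => (hCD x hx).contDiffWithinAt, fun x hx => ?_⟩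
    -- Both are the limit of m F/r: the left by C² regularity, the right by the flux identity.
    have h1 : Laplacian.laplacian u x = -k * u x :=
      tendsto_nhds_unique (tendsto_flux_of_contDiffAt hm (hCD x hx)) (hflux' x hx)
    rw [h1, hlam]
    push_cast; ring
  -- The flux is real, so a nonzero imaginary part of λ² makes all small ball means vanish, and with
  -- them their limit u(x).
  · have hzero : ∀ x ∈ D, u x = 0 := fun x hx => by
      refine tendsto_nhds_unique (hball x hx) (tendsto_const_nhds.congr' ?_)
      filter_upwards [Ioc_mem_nhdsGT (hrad x hx).1] with r hr
      have h1 := congrArg Complex.im (hflux x hx r hr)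
      have h2 : (lam ^ 2).im * (r * ballMean u x r) = 0 := by
        rw [mul_assoc, ← Complex.ofReal_mul, ← Complex.ofReal_natCast, ← Complex.ofReal_mul,
          Complex.im_mul_ofReal, Complex.ofReal_im, Complex.neg_im] at h1
        linarith
      have hr0 : r ≠ 0 := hr.1.ne'
      exact (((mul_eq_zero.1 h2).resolve_left him |> mul_eq_zero.1).resolve_left hr0).symm
    refine ⟨contDiffOn_const.congr hzero, fun x hx => ?_⟩
    have hev : u =ᶠ[𝓝 x] fun _ => 0 := by
      filter_upwards [hDopen.mem_nhds hx] with z hz using hzero z hz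
    rw [(InnerProductSpace.laplacian_congr_nhds hev).eq_of_nhds, hzero x hx,
      InnerProductSpace.laplacian_const]
    simp
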